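/- Let $d\ge 2$ and let $\{\eta_t\}_{t\ge 0}$ be the symmetric simple exclusion process on $\mathbb Z^d$, i.e. the Markov process on $\{0,1\}^{\mathbb Z^d}$ with generator $$\mathcal L_d f(\eta)=\frac1{2d}\sum_{k\in\mathbb Z^d}\ \sum_{|y-k|=1}\eta(k)(1-\eta(y))\big(f(\eta^{k,y})-f(\eta)\big)$$ for functions $f$ depending on finitely many coordinates, where $\eta^{k,y}$ is $\eta$ with the values at $k$ and $y$ exchanged. For $i=2,\dots,d$ let $g_i(u)=c_iu^{\alpha_i}+r_i$ for $u\ge 0$, with $c_i\in(0,\infty)$ and $\alpha_i,r_i\in[0,\infty)$ (so $g_i\equiv c_i+r_i$ if $\alpha_i=0$), and start the process from $$\eta_0(k)=1\big(k_1\le 0,\ |k_i|\le g_i(-k_1)\text{ for } i=2,\dots,d\big),\qquad k\in\mathbb Z^d .$$ Let $\beta=1+\sum_{i=2}^d\alpha_i$ and $$a_t=\log\Big(\frac{t}{(2\pi)^{1/(2\beta)}(\log t)^{(\beta+1)/(2\beta)}}\Big),\qquad b_t=\Big(\frac{\beta t}{d\log t}\Big)^{1/2}.$$ Fix $x\in\mathbb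 R$, put $z=z(t)=b_t(x+a_t)$, and let $N_t=\sum_{k\in\mathbb Z^d:\,k_1>z}\eta_t(k)$ be the number of particles at time $t$ whose first coordinate exceeds $z$. Then $$\lim_{t\to\infty}E[N_t]=Me^{-\beta x},\qquad M=\frac{\Gamma(\beta)}{d^{\beta/2}\beta^{(\beta+1)/2}}\Big(\prod_{i:\,\alpha_i=0}(2\lfloor c_i+r_i\rfloor+1)\Big)\Big(\prod_{i:\,\alpha_i>0}2c_i\Big).$$ -/

import Mathlib

open MeasureTheory Filter Topology
open scoped NNReal ENNReal

noncomputable section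

namespace SSEP

/-- The lattice `ℤ^d`. -/
abbrev Site (d : ℕ) := Fin d → ℤ

/-- Configurations `η ∈ {0,1}^{ℤ^d}`, with the product topology and product σ-algebra;
`η k = true` means that site `k` is occupied. -/
abbrev Config (d : ℕ) := Site d → Bool

/-- The `i`-th standard basis vector of `ℤ^d`. -/
def e {d : ℕ} (i : Fin d) : Site d := Pi.single i 1

/-- The occupation number `η(k) ∈ {0,1}` as a real number. -/
def occ {d : ℕ} (η : Config d) (k : Site d) : ℝ := if η k then 1 else 0

/-- The configuration `η^{x,y}`, in which the values at `x` and `y` are exchanged. -/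
def exchange {d : ℕ} (η : Config d) (x y : Site d) : Config d := fun k => η (Equiv.swap x y k)

/-- `f` depends on finitely many coordinates only. -/
def IsLocal {d : ℕ} (f : Config d → ℝ) : Prop := ∃ A : Finset (Site d), DependsOn f (A : Set (Site d))

/-- The contribution `η(x) (1 - η(y)) (f(η^{x,y}) - f(η))` of the attempted jump `x → y`. -/
def jumpTerm {d : ℕ} (f : Config d → ℝ) (η : Config d) (x y : Site d) : ℝ :=
  occ η x * (1 - occ η y) * (f (exchange η x y) - f η)

/-- The generator of the symmetric simple exclusion process on `ℤ^d`,
`(L f)(η) = (1 / 2d) ∑_x ∑_{|y - x| = 1} η(x) (1 - η(y)) (f(η^{x,y}) - f(η))`.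
For local `f` only finitely many `x` contribute. -/
def generator (d : ℕ) (f : Config d → ℝ) (η : Config d) : ℝ :=
  1 / (2 * (d : ℝ)) *
    ∑' x : Site d, ∑ i : Fin d, (jumpTerm f η x (x + e i) + jumpTerm f η x (x - e i))

/-- `η` is a symmetric simple exclusion process on `ℤ^d` started from `η₀`: an adapted process with
right-continuous paths with left limits that solves the martingale problem for the generator on
local functions. -/
structure IsSSEP {d : ℕ} {Ω : Type*} {m : MeasurableSpace Ω} (μ : Measure Ω)
    (ℱ : Filtration ℝ≥0 m) (η : ℝ≥0 → Ω → Config d) (η₀ : Config d) : Prop where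
  adapted : ∀ t, Measurable[ℱ t] (η t)
  initial : ∀ᵐ ω ∂μ, η 0 ω = η₀
  right_continuous : ∀ ω t, ContinuousWithinAt (fun s => η s ω) (Set.Ici t) t
  left_limits : ∀ ω t, ∃ l, Tendsto (fun s => η s ω) (𝓝[<] t) (𝓝 l)
  martingale : ∀ f : Config d → ℝ, IsLocal f →
    Martingale
      (fun (t : ℝ≥0) ω => f (η t ω) - ∫ s in (0 : ℝ)..t, generator d f (η s.toNNReal ω)) ℱ μ

/-- The number `N(z) ∈ {0, 1, …, ∞}` of particles `k` of `η` with first coordinate `k₁ > z`. -/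
def numAbove {n : ℕ} (z : ℝ) (η : Config (n + 1)) : ℝ≥0∞ :=
  ∑' k : {k : Site (n + 1) // z < (k 0 : ℝ)}, if η k then 1 else 0

open Classical in
/-- The initial profile in dimension `d = n + 1` with shape functions `g`: site `k` is occupied iff
`k₁ ≤ 0` and `|k_i| ≤ g_i(-k₁)` for each of the remaining `n` coordinates. The first coordinate is
`k 0`, and `g i` is the shape function for the coordinate `k i.succ`. -/
def profile {n : ℕ} (g : Fin n → ℝ → ℝ) : Config (n + 1) := fun k =>
  decide (k 0 ≤ 0 ∧ ∀ i : Fin n, |(k i.succ : ℝ)| ≤ g i (-(k 0 : ℝ)))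

/-- The polynomial shapes `g_i(u) = c_i u^{α_i} + r_i` (with `u^0 = 1`). -/
def polyShape {n : ℕ} (c α r : Fin n → ℝ) (i : Fin n) (u : ℝ) : ℝ := c i * u ^ α i + r i

/-- `β = 1 + ∑ α_i`. -/
def beta {n : ℕ} (α : Fin n → ℝ) : ℝ := 1 + ∑ i, α i

/-- `a_t = log (t / ((2π)^{1/(2β)} (log t)^{(β+1)/(2β)}))`. -/
def aScale (β t : ℝ) : ℝ :=
  Real.log (t / ((2 * Real.pi) ^ (1 / (2 * β)) * Real.log t ^ ((β + 1) / (2 * β))))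

/-- `b_t = (β t / (d log t))^{1/2}`. -/
def bScale (d : ℕ) (β t : ℝ) : ℝ := Real.sqrt (β * t / (d * Real.log t))

/-- The level `z = b_t (x + a_t)`. -/
def level (d : ℕ) (β x t : ℝ) : ℝ := bScale d β t * (x + aScale β t)

open Classical in
/-- The constant
`M = Γ(β) / (d^{β/2} β^{(β+1)/2}) ∏_{α_i = 0} (2⌊c_i + r_i⌋ + 1) ∏_{α_i > 0} 2 c_i`
in dimension `d = n + 1`. -/
def limitConst {n : ℕ} (c α r : Fin n → ℝ) : ℝ :=
  Real.Gamma (beta α) / (((n + 1 : ℕ) : ℝ) ^ (beta α / 2) * beta α ^ ((beta α + 1) / 2)) *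
    (∏ i with α i = 0, (2 * (⌊c i + r i⌋ : ℝ) + 1)) * ∏ i with 0 < α i, 2 * c i

end SSEP

end

/-!
The occupation numbers of the exclusion process have means that solve the closed linear equation
`u' = A u - u`, where `A` averages over the nearest neighbours: the exclusion rule cancels by
symmetry. Hence `E[N_t]` is the expected number of independent simple random walks above the level,
and only the law `p_t` of the first coordinate of such a walk enters.

At the level `z = b_t (x + a_t)` the walk is in the moderate deviation regime. Tilting its law by
`θ = β / b_t` centres it at `b_t log t`, and the local limit theorem for the tilted law gives
`b_t ^ (β + 1) p_t(z + b_t y) → β ^ ((β + 1) / 2) d ^ (-β / 2) exp (-β (x + y))`; the scale `a_t`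
is chosen so that no further prefactor survives. As the cross-section of the initial profile at
distance `u` below the origin grows like `K u ^ (β - 1)`, the sum over starting points and targets
is a Riemann sum for a Gamma integral.
-/

open scoped Nat

noncomputable section

namespace SSEP

/-- The averaging operator of the simple random walk on `ℤ^d`: `nbrAvg d f k` is the mean of `f`
over the `2d` neighbours of `k`. -/
def nbrAvg (d : ℕ) : Module.End ℝ (Site d → ℝ) :=
  (2 * (d : ℝ))⁻¹ • ∑ i, (LinearMap.funLeft ℝ ℝ (· + e i) + LinearMap.funLeft ℝ ℝ (· - e i))

section NbrAvg

variable {d : ℕ} {f : Site d → ℝ}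

lemma nbrAvg_apply (f : Site d → ℝ) (k : Site d) :
    nbrAvg d f k = (2 * (d : ℝ))⁻¹ * ∑ i, (f (k + e i) + f (k - e i)) := by
  simp [nbrAvg, LinearMap.funLeft_apply]

lemma nbrAvg_nonneg (hf : 0 ≤ f) : 0 ≤ nbrAvg d f := fun k => by
  rw [nbrAvg_apply]
  exact mul_nonneg (by positivity) (Finset.sum_nonneg fun i _ => add_nonneg (hf _) (hf _))

lemma nbrAvg_pow_nonneg (hf : 0 ≤ f) (N : ℕ) : 0 ≤ (nbrAvg d ^ N) f := by
  induction N with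
  | zero => exact hf
  | succ N ih => rw [pow_succ', Module.End.mul_apply]; exact nbrAvg_nonneg ih

lemma abs_nbrAvg_le {B : ℝ} (hf : ∀ k, |f k| ≤ B) (k : Site d) : |nbrAvg d f k| ≤ B := by
  have hB : 0 ≤ B := (abs_nonneg _).trans (hf k)
  calc |nbrAvg d f k|
      ≤ (2 * (d : ℝ))⁻¹ * ∑ i, (|f (k + e i)| + |f (k - e i)|) := by
        rw [nbrAvg_apply, abs_mul, abs_of_nonneg (by positivity : 0 ≤ (2 * (d : ℝ))⁻¹)]
        gcongr
        exact (Finset.abs_sum_le_sum_abs _ _).trans (Finset.sum_le_sum fun i _ => abs_add_le _ _)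
    _ ≤ (2 * (d : ℝ))⁻¹ * ∑ _i : Fin d, (B + B) := by gcongr <;> apply hf
    _ = (2 * (d : ℝ))⁻¹ * (2 * d) * B := by
        rw [Finset.sum_const, Finset.card_univ, Fintype.card_fin, nsmul_eq_mul]; ring
    _ ≤ 1 * B := by gcongr; exact inv_mul_le_one
    _ = B := one_mul B

section Integral

variable {X : Type*} [MeasurableSpace X] {ν : Measure X} {F : X → Site d → ℝ}

lemma measurable_nbrAvg (hF : ∀ k, Measurable fun x => F x k) (k : Site d) :
    Measurable fun x => nbrAvg d (F x) k := by
  simp only [nbrAvg_apply]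
  exact (Finset.measurable_sum _ fun i _ => (hF _).add (hF _)).const_mul _

lemma integrable_nbrAvg (hF : ∀ k, Integrable (fun x => F x k) ν) (k : Site d) :
    Integrable (fun x => nbrAvg d (F x) k) ν := by
  simp only [nbrAvg_apply]
  exact (integrable_finsetSum _ fun i _ => (hF _).add (hF _)).const_mul _

lemma integral_nbrAvg (hF : ∀ k, Integrable (fun x => F x k) ν) (k : Site d) :
    ∫ x, nbrAvg d (F x) k ∂ν = nbrAvg d (fun j => ∫ x, F x j ∂ν) k := by
  simp only [nbrAvg_apply, integral_const_mul]
  rw [integral_finsetSum _ fun i _ => by exact (hF _).add (hF _)]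
  congr! 2 with i
  exact integral_add (hF _) (hF _)

end Integral

end NbrAvg

section Occupation

variable {d : ℕ}

lemma occ_nonneg (η : Config d) : 0 ≤ occ η := fun k => by
  unfold occ; split_ifs <;> norm_num

lemma occ_le_one (η : Config d) (k : Site d) : occ η k ≤ 1 := by
  unfold occ; split_ifs <;> norm_num

lemma norm_occ_le_one (η : Config d) (k : Site d) : ‖occ η k‖ ≤ 1 := by
  rw [Real.norm_of_nonneg (occ_nonneg η k)]; exact occ_le_one η k

lemma occ_mul_self (η : Config d) (k : Site d) : occ η k * occ η k = occ η k := by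
  unfold occ; split_ifs <;> norm_num

lemma measurable_occ (k : Site d) : Measurable fun η : Config d => occ η k :=
  (measurable_of_countable fun b : Bool => if b then (1 : ℝ) else 0).comp (measurable_pi_apply k)

lemma isLocal_occ (k : Site d) : IsLocal fun η : Config d => occ η k :=
  ⟨{k}, fun x y h => by simp only [occ, h k (by simp)]⟩

lemma jumpTerm_occ (η : Config d) (k x : Site d) {v : Site d} (hv : v ≠ 0) :
    jumpTerm (fun ξ => occ ξ k) η x (x + v) =
      (if x = k then -(occ η k * (1 - occ η (k + v))) else 0) +
        (if x = k - v then occ η (k - v) * (1 - occ η k) else 0) := by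
  have hex : occ (exchange η x (x + v)) k = occ η (Equiv.swap x (x + v) k) := rfl
  simp only [jumpTerm, hex]
  by_cases hxk : x = k
  · subst hxk
    rw [if_pos rfl, if_neg fun h => hv (by simpa using h.symm), Equiv.swap_apply_left]
    linear_combination
      -(occ η x * occ_mul_self η (x + v)) - (1 - occ η (x + v)) * occ_mul_self η x
  by_cases hxv : x = k - v
  · obtain rfl : k = x + v := by rw [hxv]; abel
    rw [if_neg hxk, if_pos hxv, Equiv.swap_apply_right, add_sub_cancel_right]
    linear_combination (1 - occ η (x + v)) * occ_mul_self η x + occ η x * occ_mul_self η (x + v)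
  · rw [if_neg hxk, if_neg hxv,
      Equiv.swap_apply_of_ne_of_ne (Ne.symm hxk) fun h => hxv (by rw [h]; abel)]
    ring

lemma hasSum_jumpTerm_occ (η : Config d) (k : Site d) {v : Site d} (hv : v ≠ 0) :
    HasSum (fun x => jumpTerm (fun ξ => occ ξ k) η x (x + v))
      (-(occ η k * (1 - occ η (k + v))) + occ η (k - v) * (1 - occ η k)) := by
  simp only [jumpTerm_occ η k _ hv]
  exact (hasSum_ite_eq _ _).add (hasSum_ite_eq _ _)

/- The products `η(k) η(k ± e_i)` cancel between the jumps out of and into `k`, which is what makes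
the equation for the mean occupation numbers linear and closed. -/
lemma generator_occ [NeZero d] (η : Config d) (k : Site d) :
    generator d (fun ξ => occ ξ k) η = nbrAvg d (occ η) k - occ η k := by
  have he (i : Fin d) : (e i : Site d) ≠ 0 := by simp [e]
  have hsum := hasSum_sum fun i (_ : i ∈ Finset.univ) =>
    (hasSum_jumpTerm_occ η k (he i)).add (hasSum_jumpTerm_occ η k (neg_ne_zero.2 (he i)))
  simp only [← sub_eq_add_neg, sub_neg_eq_add] at hsum
  have hd : (d : ℝ) ≠ 0 := NeZero.ne _
  calc generator d (fun ξ => occ ξ k) η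
      = 1 / (2 * (d : ℝ)) * ∑ i, ((occ η (k + e i) + occ η (k - e i)) - 2 * occ η k) := by
        rw [generator, hsum.tsum_eq]
        congr! 2 with i
        ring
    _ = nbrAvg d (occ η) k - occ η k := by
        rw [nbrAvg_apply, Finset.sum_sub_distrib]
        simp only [Finset.sum_const, Finset.card_univ, Fintype.card_fin, nsmul_eq_mul]
        field_simp

end Occupation

section RightContinuous

lemma tendsto_floor_add_one_div_nhdsGE (s : ℝ≥0) :
    Tendsto (fun N : ℕ => ((⌊(N + 1) * s⌋₊ : ℝ≥0) + 1) / (N + 1)) atTop (𝓝[≥] s) := by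
  have hle (N : ℕ) : s ≤ ((⌊(N + 1) * s⌋₊ : ℝ≥0) + 1) / (N + 1) := by
    rw [le_div_iff₀ (by positivity), mul_comm]
    exact (Nat.lt_floor_add_one _).le
  have hge (N : ℕ) : ((⌊(N + 1) * s⌋₊ : ℝ≥0) + 1) / (N + 1) ≤ s + 1 / (N + 1) :=
    calc ((⌊(N + 1) * s⌋₊ : ℝ≥0) + 1) / (N + 1) ≤ ((N + 1) * s + 1) / (N + 1) := by
          gcongr; exact Nat.floor_le zero_le
      _ = s + 1 / (N + 1) := by field_simp
  refine tendsto_nhdsWithin_iff.2 ⟨?_, Eventually.of_forall hle⟩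
  refine tendsto_of_tendsto_of_tendsto_of_le_of_le tendsto_const_nhds ?_ hle hge
  simpa using tendsto_const_nhds.add (tendsto_one_div_add_atTop_nhds_zero_nat (𝕜 := ℝ≥0))

lemma measurable_uncurry_of_continuousWithinAt_Ici {Ω E : Type*} [MeasurableSpace Ω]
    [TopologicalSpace E] [TopologicalSpace.PseudoMetrizableSpace E] [MeasurableSpace E]
    [BorelSpace E] {u : ℝ≥0 → Ω → E} (hu : ∀ t, Measurable (u t))
    (hright : ∀ ω t, ContinuousWithinAt (fun s => u s ω) (Set.Ici t) t) :
    Measurable (Function.uncurry u) := by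
  have hgrid (ψ : ℕ → ℝ≥0) : Measurable fun q : ℕ × Ω => u (ψ q.1) q.2 :=
    measurable_from_prod_countable_right fun j => hu (ψ j)
  have hfloor (N : ℕ) : Measurable fun p : ℝ≥0 × Ω => (⌊(N + 1) * p.1⌋₊, p.2) :=
    (Nat.measurable_floor.comp (measurable_fst.const_mul _)).prodMk measurable_snd
  refine measurable_of_tendsto_metrizable
    (fun N => (hgrid fun j => ((j : ℝ≥0) + 1) / (N + 1)).comp (hfloor N)) (tendsto_pi_nhds.2 ?_)
  exact fun p => (hright p.2 p.1).tendsto.comp (tendsto_floor_add_one_div_nhdsGE p.1)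

end RightContinuous

section MeanOccupation

variable {d : ℕ} {Ω : Type*} {m : MeasurableSpace Ω} {μ : Measure Ω}
  {ℱ : Filtration ℝ≥0 m} {η : ℝ≥0 → Ω → Config d} {η₀ : Config d}

/-- The mean occupation number `E[η_t(k)]`, with the time parameter extended to `ℝ` so that the
calculus of one real variable applies; it is constant for `t ≤ 0`. -/
def meanOcc (μ : Measure Ω) (η : ℝ≥0 → Ω → Config d) (t : ℝ) (k : Site d) : ℝ :=
  ∫ ω, occ (η t.toNNReal ω) k ∂μ

lemma IsSSEP.measurable (hη : IsSSEP μ ℱ η η₀) (t : ℝ≥0) : Measurable (η t) :=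
  (hη.adapted t).mono (ℱ.le t) le_rfl

lemma IsSSEP.measurable_occ_uncurry (hη : IsSSEP μ ℱ η η₀) (k : Site d) :
    Measurable fun p : ℝ × Ω => occ (η p.1.toNNReal p.2) k :=
  (measurable_occ k).comp <|
    (measurable_uncurry_of_continuousWithinAt_Ici hη.measurable hη.right_continuous).comp <|
      (measurable_real_toNNReal.comp measurable_fst).prodMk measurable_snd

variable [IsProbabilityMeasure μ]

lemma IsSSEP.integrable_occ (hη : IsSSEP μ ℱ η η₀) (t : ℝ) (k : Site d) :
    Integrable (fun ω => occ (η t.toNNReal ω) k) μ :=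
  .of_bound ((measurable_occ k).comp (hη.measurable _)).aestronglyMeasurable 1
    (Eventually.of_forall fun _ => norm_occ_le_one _ k)

lemma abs_meanOcc_le_one (t : ℝ) (k : Site d) : |meanOcc μ η t k| ≤ 1 := by
  simpa [meanOcc] using
    norm_integral_le_of_norm_le_const (μ := μ) (Eventually.of_forall fun ω => norm_occ_le_one _ k)

lemma IsSSEP.meanOcc_zero (hη : IsSSEP μ ℱ η η₀) : meanOcc μ η 0 = occ η₀ := by
  ext k
  have h : (fun ω => occ (η 0 ω) k) =ᵐ[μ] fun _ => occ η₀ k :=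
    hη.initial.mono fun ω h => by simp only [h]
  rw [meanOcc, Real.toNNReal_zero, integral_congr_ae h]
  simp

lemma IsSSEP.integral_generator_occ [NeZero d] (hη : IsSSEP μ ℱ η η₀) (s : ℝ) (k : Site d) :
    ∫ ω, generator d (fun ξ => occ ξ k) (η s.toNNReal ω) ∂μ =
      nbrAvg d (meanOcc μ η s) k - meanOcc μ η s k := by
  simp only [generator_occ]
  rw [integral_sub (integrable_nbrAvg (hη.integrable_occ s) k) (hη.integrable_occ s k),
    integral_nbrAvg (hη.integrable_occ s)]
  rfl

lemma IsSSEP.integrable_generator_occ [NeZero d] (hη : IsSSEP μ ℱ η η₀) (t : ℝ) (k : Site d) :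
    Integrable (Function.uncurry fun (s : ℝ) ω => generator d (fun ξ => occ ξ k) (η s.toNNReal ω))
      ((volume.restrict (Set.uIoc 0 t)).prod μ) := by
  have : IsFiniteMeasure (volume.restrict (Set.uIoc 0 t)) := ⟨by simp [Set.uIoc]⟩
  simp only [generator_occ]
  refine .of_bound (C := 1 + 1) ((measurable_nbrAvg hη.measurable_occ_uncurry k).sub
    (hη.measurable_occ_uncurry k)).aestronglyMeasurable (Eventually.of_forall fun p => ?_)
  exact (norm_sub_le _ _).trans
    (add_le_add (abs_nbrAvg_le (norm_occ_le_one _) k) (norm_occ_le_one _ k))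

lemma IsSSEP.meanOcc_eq_add_integral [NeZero d] (hη : IsSSEP μ ℱ η η₀) {t : ℝ} (ht : 0 ≤ t)
    (k : Site d) :
    meanOcc μ η t k = occ η₀ k +
      ∫ s in (0 : ℝ)..t, (nbrAvg d (meanOcc μ η s) k - meanOcc μ η s k) := by
  have hmart := (hη.martingale _ (isLocal_occ k)).setIntegral_eq (zero_le (a := t.toNNReal))
    (s := Set.univ) MeasurableSet.univ
  simp only [Measure.restrict_univ, NNReal.coe_zero, intervalIntegral.integral_same, sub_zero,
    Real.coe_toNNReal t ht] at hmart
  have hint := hη.integrable_generator_occ t k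
  have hdrift : Integrable
      (fun ω => ∫ s in (0 : ℝ)..t, generator d (fun ξ => occ ξ k) (η s.toNNReal ω)) μ := by
    simpa only [intervalIntegral.integral_of_le ht, Set.uIoc_of_le ht,
      Function.uncurry_apply_pair] using hint.integral_prod_right
  rw [integral_sub (hη.integrable_occ t k) hdrift, ← intervalIntegral_integral_swap hint] at hmart
  simp only [hη.integral_generator_occ] at hmart
  rw [← hη.meanOcc_zero, meanOcc, meanOcc, Real.toNNReal_zero, hmart]
  ring

lemma IsSSEP.intervalIntegrable_drift [NeZero d] (hη : IsSSEP μ ℱ η η₀) (t : ℝ) (k : Site d) :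
    IntervalIntegrable (fun s => nbrAvg d (meanOcc μ η s) k - meanOcc μ η s k) volume 0 t := by
  rw [intervalIntegrable_iff]
  simpa only [IntegrableOn, Function.uncurry_apply_pair, hη.integral_generator_occ] using
    (hη.integrable_generator_occ t k).integral_prod_left

lemma IsSSEP.continuousOn_meanOcc [NeZero d] (hη : IsSSEP μ ℱ η η₀) (k : Site d) :
    ContinuousOn (fun t => meanOcc μ η t k) (Set.Ici 0) := by
  refine ContinuousOn.congr (f := fun t => occ η₀ k +
    ∫ s in (0 : ℝ)..t, (nbrAvg d (meanOcc μ η s) k - meanOcc μ η s k)) ?_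
    fun t ht => hη.meanOcc_eq_add_integral ht k
  exact continuousOn_const.add <| Continuous.continuousOn <|
    intervalIntegral.continuous_primitive (fun a b =>
      (hη.intervalIntegrable_drift a k).symm.trans (hη.intervalIntegrable_drift b k)) 0

lemma IsSSEP.hasDerivWithinAt_meanOcc [NeZero d] (hη : IsSSEP μ ℱ η η₀) {t : ℝ} (ht : 0 ≤ t)
    (k : Site d) :
    HasDerivWithinAt (fun s => meanOcc μ η s k)
      (nbrAvg d (meanOcc μ η t) k - meanOcc μ η t k) (Set.Ici t) t := by
  have hcont (j : Site d) : ContinuousWithinAt (fun s => meanOcc μ η s j) (Set.Ioi t) t :=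
    (hη.continuousOn_meanOcc j t ht).mono fun s hs => ht.trans (le_of_lt hs)
  have hdrift : ContinuousWithinAt
      (fun s => nbrAvg d (meanOcc μ η s) k - meanOcc μ η s k) (Set.Ioi t) t := by
    simp only [nbrAvg_apply]
    exact ((tendsto_finsetSum _ fun i _ => (hcont _).add (hcont _)).const_mul _).sub (hcont k)
  have hmeas : StronglyMeasurableAtFilter
      (fun s => nbrAvg d (meanOcc μ η s) k - meanOcc μ η s k) (𝓝[>] t) :=
    ⟨Set.Ioc t (t + 1), Ioc_mem_nhdsGT (lt_add_one t),
      ((hη.intervalIntegrable_drift t k).symm.trans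
        (hη.intervalIntegrable_drift (t + 1) k)).1.aestronglyMeasurable⟩
  exact ((intervalIntegral.integral_hasDerivWithinAt_right (hη.intervalIntegrable_drift t k) hmeas
    hdrift).const_add (occ η₀ k)).congr
      (fun s hs => hη.meanOcc_eq_add_integral (ht.trans hs) k) (hη.meanOcc_eq_add_integral ht k)

end MeanOccupation

section ExponentialSeries

variable {ι : Type*} {A : Module.End ℝ (ι → ℝ)}

lemma hasDerivAt_pow_div_factorial (N : ℕ) (t : ℝ) :
    HasDerivAt (fun s : ℝ => s ^ (N + 1) / (N + 1)!) (t ^ N / N !) t := by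
  refine ((hasDerivAt_pow (N + 1) t).div_const _).congr_deriv ?_
  rw [Nat.factorial_succ]
  push_cast
  field_simp

/-- The Taylor polynomial of `t ↦ exp (t A) f` with `N` terms. -/
def expTaylor (A : Module.End ℝ (ι → ℝ)) (f : ι → ℝ) (N : ℕ) (t : ℝ) : ι → ℝ :=
  ∑ i ∈ Finset.range N, (t ^ i / i !) • (A ^ i) f

lemma expTaylor_apply (f : ι → ℝ) (N : ℕ) (t : ℝ) (k : ι) :
    expTaylor A f N t k = ∑ i ∈ Finset.range N, t ^ i / i ! * (A ^ i) f k := by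
  simp [expTaylor]

lemma expTaylor_succ_zero (f : ι → ℝ) (N : ℕ) : expTaylor A f (N + 1) 0 = f := by
  simp [expTaylor, Finset.sum_range_succ']

lemma hasDerivAt_expTaylor_succ (f : ι → ℝ) (N : ℕ) (t : ℝ) (k : ι) :
    HasDerivAt (fun s => expTaylor A f (N + 1) s k) (A (expTaylor A f N t) k) t := by
  have hA : A (expTaylor A f N t) k = ∑ i ∈ Finset.range N, t ^ i / i ! * (A ^ (i + 1)) f k := by
    simp [expTaylor, pow_succ']
  simp only [hA, expTaylor_apply, Finset.sum_range_succ' _ N, pow_zero]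
  exact (HasDerivAt.fun_sum fun i _ => (hasDerivAt_pow_div_factorial i t).mul_const _).add_const _

variable {u : ℝ → ι → ℝ} {B : ℝ}

lemma abs_sub_expTaylor_le (hA : ∀ f C, (∀ k, |f k| ≤ C) → ∀ k, |A f k| ≤ C)
    (hbound : ∀ t k, |u t k| ≤ B) (hcont : ∀ k, ContinuousOn (fun t => u t k) (Set.Ici 0))
    (hderiv : ∀ t, 0 ≤ t → ∀ k,
      HasDerivWithinAt (fun s => u s k) (A (u t) k - u t k) (Set.Ici t) t)
    {T : ℝ} (N : ℕ) {t : ℝ} (ht : t ∈ Set.Icc 0 T) (k : ι) :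
    |Real.exp t * u t k - expTaylor A (u 0) N t k| ≤ B * Real.exp T * (t ^ N / N !) := by
  have hB : 0 ≤ B := (abs_nonneg _).trans (hbound 0 k)
  induction N generalizing t k with
  | zero =>
    simp only [expTaylor, Finset.sum_range_zero, Pi.zero_apply, sub_zero, pow_zero,
      Nat.factorial_zero, Nat.cast_one, div_one, mul_one, abs_mul, Real.abs_exp]
    rw [mul_comm]
    gcongr
    exacts [hbound t k, ht.2]
  | succ N ih =>
    refine image_norm_le_of_norm_deriv_right_le_deriv_boundary
      (f := fun s => Real.exp s * u s k - expTaylor A (u 0) (N + 1) s k)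
      (f' := fun s => A (Real.exp s • u s - expTaylor A (u 0) N s) k)
      (B := fun s => B * Real.exp T * (s ^ (N + 1) / (N + 1)!)) ?_ (fun s hs => ?_) ?_
      (fun s => (hasDerivAt_pow_div_factorial N s).const_mul _) (fun s hs => ?_) ht
    · refine (Real.continuous_exp.continuousOn.mul
        ((hcont k).mono Set.Icc_subset_Ici_self)).sub fun s _ => ?_
      exact (hasDerivAt_expTaylor_succ _ N s k).continuousAt.continuousWithinAt
    · refine (((Real.hasDerivAt_exp s).hasDerivWithinAt.mul (hderiv s hs.1 k)).sub
        (hasDerivAt_expTaylor_succ (u 0) N s k).hasDerivWithinAt).congr_deriv ?_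
      simp only [map_sub, map_smul, Pi.sub_apply, Pi.smul_apply, smul_eq_mul]
      ring
    · simp [expTaylor_succ_zero]
    · exact hA _ _ (fun j => ih (Set.Ico_subset_Icc_self hs) j) k

/- The time derivative gains a factor `t / (N + 1)` at each application of the equation, so
boundedness of the solution alone forces the Taylor series to converge to it. -/
lemma hasSum_of_hasDerivWithinAt (hA : ∀ f C, (∀ k, |f k| ≤ C) → ∀ k, |A f k| ≤ C)
    (hbound : ∀ t k, |u t k| ≤ B) (hcont : ∀ k, ContinuousOn (fun t => u t k) (Set.Ici 0))
    (hderiv : ∀ t, 0 ≤ t → ∀ k,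
      HasDerivWithinAt (fun s => u s k) (A (u t) k - u t k) (Set.Ici t) t)
    {t : ℝ} (ht : 0 ≤ t) (k : ι) :
    HasSum (fun N => Real.exp (-t) * (t ^ N / N !) * (A ^ N) (u 0) k) (u t k) := by
  have hsummable : Summable fun N => t ^ N / N ! * (A ^ N) (u 0) k := by
    refine .of_norm_bounded ((Real.summable_pow_div_factorial t).mul_right B) fun N => ?_
    have hpow (N : ℕ) : ∀ j, |(A ^ N) (u 0) j| ≤ B := by
      induction N with
      | zero => exact hbound 0
      | succ N ih => rw [pow_succ']; exact hA _ _ ih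
    rw [norm_mul, Real.norm_of_nonneg (by positivity)]
    gcongr
    exact hpow N k
  have htaylor : Tendsto (fun N => expTaylor A (u 0) N t k) atTop (𝓝 (Real.exp t * u t k)) := by
    have hzero := (FloorSemiring.tendsto_pow_div_factorial_atTop t).const_mul (B * Real.exp t)
    rw [mul_zero] at hzero
    exact tendsto_sub_nhds_zero_iff.1 <| squeeze_zero_norm (fun N => by
      rw [norm_sub_rev]
      exact abs_sub_expTaylor_le hA hbound hcont hderiv N ⟨ht, le_rfl⟩ k) hzero
  simp only [expTaylor_apply] at htaylor
  have hsum := ((hsummable.hasSum_iff_tendsto_nat).2 htaylor).mul_left (Real.exp (-t))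
  simpa only [← mul_assoc, ← Real.exp_add, neg_add_cancel, Real.exp_zero, one_mul] using hsum

end ExponentialSeries

section

variable {d : ℕ} [NeZero d] {Ω : Type*} {m : MeasurableSpace Ω} {μ : Measure Ω}
  [IsProbabilityMeasure μ] {ℱ : Filtration ℝ≥0 m} {η : ℝ≥0 → Ω → Config d} {η₀ : Config d}

lemma IsSSEP.hasSum_meanOcc (hη : IsSSEP μ ℱ η η₀) {t : ℝ} (ht : 0 ≤ t) (k : Site d) :
    HasSum (fun N => Real.exp (-t) * (t ^ N / N !) * (nbrAvg d ^ N) (occ η₀) k)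
      (meanOcc μ η t k) := by
  rw [← hη.meanOcc_zero]
  exact hasSum_of_hasDerivWithinAt (fun _ _ => abs_nbrAvg_le) abs_meanOcc_le_one
    hη.continuousOn_meanOcc (fun _ => hη.hasDerivWithinAt_meanOcc) ht k

end

section Slices

variable {n : ℕ}

/-- The total mass of `f` on the hyperplane of the sites with first coordinate `p`. -/
def sliceMass (f : Site (n + 1) → ℝ) (p : ℤ) : ℝ≥0∞ :=
  ∑' k : Site n, ENNReal.ofReal (f (Fin.cons p k))

/-- The set of particles of `η` on the hyperplane of the sites with first coordinate `p`. -/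
def slice (η : Config (n + 1)) (p : ℤ) : Set (Site n) := {k | η (Fin.cons p k)}

lemma sliceMass_occ (η : Config (n + 1)) (p : ℤ) :
    sliceMass (occ η) p = ((slice η p).encard : ℝ≥0∞) := by
  rw [sliceMass, ← ENNReal.tsum_set_one,
    tsum_subtype (slice η p) fun _ => (1 : ℝ≥0∞)]
  congr! 2 with k
  by_cases h : η (Fin.cons p k) <;> simp [slice, occ, h]

lemma tsum_ofReal_cons_add (f : Site (n + 1) → ℝ) (p : ℤ) (v : Site (n + 1)) :
    ∑' k : Site n, ENNReal.ofReal (f (Fin.cons p k + v)) = sliceMass f (p + v 0) := by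
  rw [sliceMass, ← (Equiv.addRight (Fin.tail v)).tsum_eq
    fun k => ENNReal.ofReal (f (Fin.cons (p + v 0) k))]
  congr! 4 with k
  ext i
  cases i using Fin.cases <;> simp [Fin.tail]

lemma ofReal_nbrAvg {d : ℕ} {f : Site d → ℝ} (hf : 0 ≤ f) (k : Site d) :
    ENNReal.ofReal (nbrAvg d f k) = ENNReal.ofReal (2 * (d : ℝ))⁻¹ *
      ∑ i, (ENNReal.ofReal (f (k + e i)) + ENNReal.ofReal (f (k + -e i))) := by
  rw [nbrAvg_apply, ENNReal.ofReal_mul (by positivity),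
    ENNReal.ofReal_sum_of_nonneg fun i _ => add_nonneg (hf _) (hf _)]
  congr! 2 with i
  rw [ENNReal.ofReal_add (hf _) (hf _), ← sub_eq_add_neg]

lemma sliceMass_nbrAvg {f : Site (n + 1) → ℝ} (hf : 0 ≤ f) (p : ℤ) :
    sliceMass (nbrAvg (n + 1) f) p =
      ENNReal.ofReal (1 - ((n + 1 : ℕ) : ℝ)⁻¹) * sliceMass f p +
        ENNReal.ofReal (2 * ((n + 1 : ℕ) : ℝ))⁻¹ *
          (sliceMass f (p - 1) + sliceMass f (p + 1)) := by
  have hlazy : ENNReal.ofReal (1 - ((n + 1 : ℕ) : ℝ)⁻¹) =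
      ENNReal.ofReal (2 * ((n + 1 : ℕ) : ℝ))⁻¹ * (n * 2) := by
    rw [← ENNReal.ofReal_natCast, ← ENNReal.ofReal_ofNat 2, ← ENNReal.ofReal_mul (by positivity),
      ← ENNReal.ofReal_mul (by positivity)]
    congr 1
    push_cast
    field_simp
    ring
  simp only [sliceMass, ofReal_nbrAvg hf]
  rw [ENNReal.tsum_mul_left, Summable.tsum_finsetSum fun _ _ => ENNReal.summable]
  simp only [ENNReal.tsum_add, tsum_ofReal_cons_add, Fin.sum_univ_succ]
  simp only [e, Pi.neg_apply, Pi.single_eq_same, Pi.single_eq_of_ne (Fin.succ_ne_zero _).symm,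
    neg_zero, add_zero, ← sub_eq_add_neg, Finset.sum_const, Finset.card_univ, Fintype.card_fin,
    nsmul_eq_mul, hlazy]
  simp only [sliceMass]
  ring

end Slices

section FirstCoordinate

variable {d : ℕ} {t : ℝ}

/-- The law after `N` steps of the first coordinate of the simple random walk on `ℤ^d`, a lazy
simple random walk on `ℤ`. -/
def walkLaw (d : ℕ) : ℕ → ℤ → ℝ
  | 0, j => if j = 0 then 1 else 0
  | N + 1, j => (1 - (d : ℝ)⁻¹) * walkLaw d N j +
      (2 * (d : ℝ))⁻¹ * (walkLaw d N (j - 1) + walkLaw d N (j + 1))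

/-- The law at time `t` of the first coordinate of the simple random walk on `ℤ^d` that jumps at
rate `1`. -/
def heatKernel (d : ℕ) (t : ℝ) (j : ℤ) : ℝ :=
  ∑' N : ℕ, Real.exp (-t) * (t ^ N / N !) * walkLaw d N j

lemma walkLaw_nonneg (N : ℕ) (j : ℤ) : 0 ≤ walkLaw d N j := by
  induction N generalizing j with
  | zero => unfold walkLaw; split_ifs <;> norm_num
  | succ N ih =>
    have hlazy : 0 ≤ 1 - (d : ℝ)⁻¹ := sub_nonneg.2 (Nat.cast_inv_le_one d)
    exact add_nonneg (mul_nonneg hlazy (ih j))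
      (mul_nonneg (by positivity) (add_nonneg (ih _) (ih _)))

lemma walkLaw_le_one (N : ℕ) (j : ℤ) : walkLaw d N j ≤ 1 := by
  induction N generalizing j with
  | zero => unfold walkLaw; split_ifs <;> norm_num
  | succ N ih =>
    have hlazy : 0 ≤ 1 - (d : ℝ)⁻¹ := sub_nonneg.2 (Nat.cast_inv_le_one d)
    calc walkLaw d (N + 1) j
        ≤ (1 - (d : ℝ)⁻¹) * 1 + (2 * (d : ℝ))⁻¹ * (1 + 1) := by
          rw [walkLaw]; gcongr <;> apply ih
      _ = 1 := by rw [mul_inv]; ring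

lemma sliceMass_nbrAvg_pow {n : ℕ} {f : Site (n + 1) → ℝ} (hf : 0 ≤ f) (N : ℕ) (p : ℤ) :
    sliceMass ((nbrAvg (n + 1) ^ N) f) p =
      ∑' q, ENNReal.ofReal (walkLaw (n + 1) N (p - q)) * sliceMass f q := by
  induction N generalizing p with
  | zero =>
    rw [tsum_eq_single p fun q hq => by simp [walkLaw, sub_eq_zero, hq.symm]]
    simp [walkLaw]
  | succ N ih =>
    rw [pow_succ', Module.End.mul_apply, sliceMass_nbrAvg (nbrAvg_pow_nonneg hf N)]
    simp only [ih, ← ENNReal.tsum_add, ← ENNReal.tsum_mul_left]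
    congr! 2 with q
    have hlazy : 0 ≤ 1 - ((n + 1 : ℕ) : ℝ)⁻¹ := sub_nonneg.2 (Nat.cast_inv_le_one _)
    rw [walkLaw, ENNReal.ofReal_add (mul_nonneg hlazy (walkLaw_nonneg _ _))
        (mul_nonneg (by positivity) (add_nonneg (walkLaw_nonneg _ _) (walkLaw_nonneg _ _))),
      ENNReal.ofReal_mul hlazy, ENNReal.ofReal_mul (by positivity),
      ENNReal.ofReal_add (walkLaw_nonneg _ _) (walkLaw_nonneg _ _), sub_right_comm,
      sub_add_eq_add_sub]
    ring

lemma summable_heatKernel (ht : 0 ≤ t) (j : ℤ) :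
    Summable fun N : ℕ => Real.exp (-t) * (t ^ N / N !) * walkLaw d N j :=
  .of_nonneg_of_le (fun N => mul_nonneg (by positivity) (walkLaw_nonneg N j))
    (fun N => mul_le_of_le_one_right (by positivity) (walkLaw_le_one N j))
    ((Real.summable_pow_div_factorial t).mul_left (Real.exp (-t)))

lemma ofReal_heatKernel (ht : 0 ≤ t) (j : ℤ) :
    ENNReal.ofReal (heatKernel d t j) =
      ∑' N : ℕ,
        ENNReal.ofReal (Real.exp (-t) * (t ^ N / N !)) * ENNReal.ofReal (walkLaw d N j) := by
  rw [heatKernel, ENNReal.ofReal_tsum_of_nonneg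
    (fun N => mul_nonneg (by positivity) (walkLaw_nonneg N j)) (summable_heatKernel ht j)]
  exact tsum_congr fun N => ENNReal.ofReal_mul (by positivity)

end FirstCoordinate

section ExpectedCount

variable {n : ℕ} {Ω : Type*} {m : MeasurableSpace Ω} {μ : Measure Ω} [IsProbabilityMeasure μ]
  {ℱ : Filtration ℝ≥0 m} {η : ℝ≥0 → Ω → Config (n + 1)} {η₀ : Config (n + 1)}

lemma IsSSEP.sliceMass_meanOcc (hη : IsSSEP μ ℱ η η₀) (t : ℝ≥0) (p : ℤ) :
    sliceMass (meanOcc μ η t) p =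
      ∑' q, ENNReal.ofReal (heatKernel (n + 1) t (p - q)) * ((slice η₀ q).encard : ℝ≥0∞) := by
  have hmean (k : Site (n + 1)) : ENNReal.ofReal (meanOcc μ η t k) =
      ∑' N : ℕ, ENNReal.ofReal (Real.exp (-t) * ((t : ℝ) ^ N / N !)) *
        ENNReal.ofReal ((nbrAvg (n + 1) ^ N) (occ η₀) k) := by
    have hsum := hη.hasSum_meanOcc t.coe_nonneg k
    have hpow (N : ℕ) := nbrAvg_pow_nonneg (occ_nonneg η₀) N k
    rw [← hsum.tsum_eq, ENNReal.ofReal_tsum_of_nonneg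
      (fun N => mul_nonneg (by positivity) (hpow N)) hsum.summable]
    exact tsum_congr fun N => ENNReal.ofReal_mul (by positivity)
  calc sliceMass (meanOcc μ η t) p
      = ∑' N : ℕ, ENNReal.ofReal (Real.exp (-t) * ((t : ℝ) ^ N / N !)) *
          sliceMass ((nbrAvg (n + 1) ^ N) (occ η₀)) p := by
        simp only [sliceMass, hmean]
        rw [ENNReal.tsum_comm]
        simp only [ENNReal.tsum_mul_left]
    _ = ∑' q, ∑' N : ℕ, ENNReal.ofReal (Real.exp (-t) * ((t : ℝ) ^ N / N !)) *
          ENNReal.ofReal (walkLaw (n + 1) N (p - q)) * ((slice η₀ q).encard : ℝ≥0∞) := by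
        simp only [sliceMass_nbrAvg_pow (occ_nonneg η₀), sliceMass_occ, ← ENNReal.tsum_mul_left,
          mul_assoc]
        rw [ENNReal.tsum_comm]
    _ = ∑' q, ENNReal.ofReal (heatKernel (n + 1) t (p - q)) * ((slice η₀ q).encard : ℝ≥0∞) := by
        simp only [ENNReal.tsum_mul_right, ← ofReal_heatKernel t.coe_nonneg]

/-- The sites with first coordinate above `z`, as pairs of a height above `⌊z⌋` and a site of the
corresponding hyperplane. -/
def aboveEquiv (n : ℕ) (z : ℝ) : ℕ × Site n ≃ {k : Site (n + 1) // z < (k 0 : ℝ)} where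
  toFun q := ⟨Fin.cons (⌊z⌋ + 1 + q.1) q.2, Int.floor_lt.1 (by rw [Fin.cons_zero]; lia)⟩
  invFun k := ((k.1 0 - (⌊z⌋ + 1)).toNat, Fin.tail k.1)
  left_inv q := by ext <;> simp [Fin.tail]
  right_inv k := by
    have hk : ⌊z⌋ < k.1 0 := Int.floor_lt.2 k.2
    ext i
    cases i using Fin.cases
    · simp only [Fin.cons_zero]; lia
    · simp [Fin.tail]

lemma IsSSEP.lintegral_numAbove (hη : IsSSEP μ ℱ η η₀) (z : ℝ) (t : ℝ≥0) :
    ∫⁻ ω, numAbove z (η t ω) ∂μ = ∑' j : ℕ, sliceMass (meanOcc μ η t) (⌊z⌋ + 1 + j) := by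
  have hocc (ξ : Config (n + 1)) (k) :
      (if ξ k then (1 : ℝ≥0∞) else 0) = ENNReal.ofReal (occ ξ k) := by
    unfold occ; split_ifs <;> simp
  have hmean (k) : ∫⁻ ω, ENNReal.ofReal (occ (η t ω) k) ∂μ = ENNReal.ofReal (meanOcc μ η t k) := by
    have hint := hη.integrable_occ t k
    rw [Real.toNNReal_coe] at hint
    rw [← ofReal_integral_eq_lintegral_ofReal hint (Eventually.of_forall fun _ => occ_nonneg _ k),
      meanOcc, Real.toNNReal_coe]
  simp only [numAbove, hocc]
  rw [lintegral_tsum fun k => by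
    exact ((measurable_occ k.1).comp (hη.measurable t)).ennreal_ofReal.aemeasurable]
  simp only [hmean]
  rw [← (aboveEquiv n z).tsum_eq, ENNReal.tsum_prod']
  rfl

lemma IsSSEP.lintegral_numAbove_eq_tsum_heatKernel (hη : IsSSEP μ ℱ η η₀)
    (hpos : ∀ p, 0 < p → slice η₀ p = ∅) (z : ℝ) (t : ℝ≥0) :
    ∫⁻ ω, numAbove z (η t ω) ∂μ = ∑' (j : ℕ) (u : ℕ),
      ENNReal.ofReal (heatKernel (n + 1) t (⌊z⌋ + 1 + j + u)) *
        ((slice η₀ (-u)).encard : ℝ≥0∞) := by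
  rw [hη.lintegral_numAbove]
  congr! 2 with j
  have hinj : Function.Injective fun u : ℕ => -(u : ℤ) := neg_injective.comp Nat.cast_injective
  rw [hη.sliceMass_meanOcc, ← hinj.tsum_eq]
  · simp only [sub_neg_eq_add]
  · intro q hq
    have hq' : ¬0 < q := fun h => hq (by simp [hpos q h])
    exact ⟨q.natAbs, by lia⟩

end ExpectedCount

section Fourier

variable {d : ℕ} {t : ℝ}

/-- The Laplace transform `∑ j, exp (j w) * walkLaw d 1 j` of one step of the first coordinate of
the simple random walk on `ℤ^d`. -/
def stepMult (d : ℕ) (w : ℂ) : ℂ := 1 - (d : ℂ)⁻¹ + (d : ℂ)⁻¹ * Complex.cosh w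

@[fun_prop]
lemma continuous_stepMult : Continuous (stepMult d) := by
  unfold stepMult
  fun_prop

lemma integral_exp_neg_int_mul (j : ℤ) (θ : ℝ) :
    ∫ s in (-Real.pi)..Real.pi, Complex.exp (-j * (θ + s * Complex.I)) =
      (if j = 0 then 1 else 0) * (2 * Real.pi) := by
  split_ifs with hj
  · simp [hj, two_mul]
  have hc : (-j * Complex.I : ℂ) ≠ 0 := by simp [hj]
  have hfactor (s : ℝ) : Complex.exp (-j * (θ + s * Complex.I)) =
      Complex.exp (-j * θ) * Complex.exp ((-j * Complex.I) * s) := by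
    rw [← Complex.exp_add]; ring_nf
  have hperiod : Complex.exp ((-j * Complex.I) * (Real.pi : ℝ)) =
      Complex.exp ((-j * Complex.I) * ((-Real.pi : ℝ) : ℝ)) :=
    Complex.exp_eq_exp_iff_exists_int.2 ⟨-j, by push_cast; ring⟩
  simp only [hfactor]
  rw [intervalIntegral.integral_const_mul, integral_exp_mul_complex hc, hperiod, sub_self,
    zero_div, mul_zero, zero_mul]

lemma walkLaw_mul_two_pi (N : ℕ) (j : ℤ) (θ : ℝ) :
    (walkLaw d N j : ℂ) * (2 * Real.pi) = ∫ s in (-Real.pi)..Real.pi,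
      Complex.exp (-j * (θ + s * Complex.I)) * stepMult d (θ + s * Complex.I) ^ N := by
  induction N generalizing j with
  | zero =>
    simp only [pow_zero, mul_one, integral_exp_neg_int_mul, walkLaw]
    split_ifs <;> simp
  | succ N ih =>
    have hstep (s : ℝ) :
        Complex.exp (-j * (θ + s * Complex.I)) * stepMult d (θ + s * Complex.I) ^ (N + 1) =
        (1 - (d : ℂ)⁻¹) *
          (Complex.exp (-j * (θ + s * Complex.I)) * stepMult d (θ + s * Complex.I) ^ N) +
        (2 * (d : ℂ))⁻¹ *
          (Complex.exp (-(j - 1 : ℤ) * (θ + s * Complex.I)) * stepMult d (θ + s * Complex.I) ^ N +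
          Complex.exp (-(j + 1 : ℤ) * (θ + s * Complex.I)) *
            stepMult d (θ + s * Complex.I) ^ N) := by
      generalize (θ + s * Complex.I : ℂ) = w
      have hsub : Complex.exp (-(j - 1 : ℤ) * w) = Complex.exp (-j * w) * Complex.exp w := by
        rw [← Complex.exp_add]; push_cast; ring_nf
      have hadd : Complex.exp (-(j + 1 : ℤ) * w) = Complex.exp (-j * w) * Complex.exp (-w) := by
        rw [← Complex.exp_add]; push_cast; ring_nf
      rw [hsub, hadd, pow_succ, mul_inv, stepMult, Complex.cosh]
      ring
    have hint (i : ℤ) : IntervalIntegrable (fun s : ℝ =>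
        Complex.exp (-i * (θ + s * Complex.I)) * stepMult d (θ + s * Complex.I) ^ N) volume
        (-Real.pi) Real.pi := Continuous.intervalIntegrable (by fun_prop) _ _
    simp only [hstep]
    rw [intervalIntegral.integral_add ((hint j).const_mul _)
      (((hint _).add (hint _)).const_mul _), intervalIntegral.integral_const_mul,
      intervalIntegral.integral_const_mul, intervalIntegral.integral_add (hint _) (hint _),
      ← ih, ← ih, ← ih]
    simp only [walkLaw]
    push_cast
    ring

lemma hasSum_exp_stepMult (t : ℝ) (j : ℤ) (w : ℂ) :
    HasSum (fun N : ℕ => Real.exp (-t) * (t ^ N / N !) * (Complex.exp (-j * w) * stepMult d w ^ N))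
      (Complex.exp ((t / d : ℝ) * (Complex.cosh w - 1) - j * w)) := by
  have hvalue : Complex.exp ((t / d : ℝ) * (Complex.cosh w - 1) - j * w) =
      Real.exp (-t) * Complex.exp (-j * w) * Complex.exp (t * stepMult d w) := by
    rw [Complex.ofReal_exp, ← Complex.exp_add, ← Complex.exp_add, stepMult]
    push_cast
    ring_nf
  have hterm (N : ℕ) : (Real.exp (-t) * (t ^ N / N !) * (Complex.exp (-j * w) * stepMult d w ^ N) :
      ℂ) = Real.exp (-t) * Complex.exp (-j * w) * ((t * stepMult d w) ^ N / N !) := by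
    rw [mul_pow]
    ring
  have hexp : HasSum (fun N : ℕ => (t * stepMult d w) ^ N / N !) (Complex.exp (t * stepMult d w)) :=
    Complex.exp_eq_exp_ℂ ▸ NormedSpace.expSeries_div_hasSum_exp _
  simp only [hvalue, hterm]
  exact hexp.mul_left _

lemma heatKernel_mul_two_pi (ht : 0 ≤ t) (j : ℤ) (θ : ℝ) :
    (heatKernel d t j : ℂ) * (2 * Real.pi) = ∫ s in (-Real.pi)..Real.pi,
      Complex.exp ((t / d : ℝ) * (Complex.cosh (θ + s * Complex.I) - 1) -
        j * (θ + s * Complex.I)) := by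
  have hsum : HasSum (fun N : ℕ => ∫ s in (-Real.pi)..Real.pi, (Real.exp (-t) * (t ^ N / N !) *
      (Complex.exp (-j * (θ + s * Complex.I)) * stepMult d (θ + s * Complex.I) ^ N) : ℂ))
      ((heatKernel d t j : ℂ) * (2 * Real.pi)) := by
    have hterm (N : ℕ) : ∫ s in (-Real.pi)..Real.pi, (Real.exp (-t) * (t ^ N / N !) *
        (Complex.exp (-j * (θ + s * Complex.I)) * stepMult d (θ + s * Complex.I) ^ N) : ℂ) =
        ((Real.exp (-t) * (t ^ N / N !) * walkLaw d N j : ℝ) : ℂ) * (2 * Real.pi) := by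
      rw [intervalIntegral.integral_const_mul, ← walkLaw_mul_two_pi]
      push_cast
      ring
    simp only [hterm]
    exact (Complex.hasSum_ofReal.2 (summable_heatKernel ht j).hasSum).mul_right _
  obtain ⟨C, hC⟩ := isCompact_uIcc.exists_bound_of_continuousOn (s := Set.uIcc (-Real.pi) Real.pi)
    (f := fun s : ℝ => stepMult d (θ + s * Complex.I)) (Continuous.continuousOn (by fun_prop))
  refine hsum.unique (intervalIntegral.hasSum_integral_of_dominated_convergence
    (fun N _ => Real.exp (-t) * Real.exp (-j * θ) * ((t * C) ^ N / N !))
    (fun N => Continuous.aestronglyMeasurable (by fun_prop))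
    (fun N => Eventually.of_forall fun s hs => ?_)
    (Eventually.of_forall fun s _ => (Real.summable_pow_div_factorial _).mul_left _)
    intervalIntegrable_const (Eventually.of_forall fun s _ => hasSum_exp_stepMult t j _))
  have hre : (-(j : ℂ) * (θ + s * Complex.I)).re = -j * θ := by simp
  calc ‖(Real.exp (-t) * (t ^ N / N !) *
        (Complex.exp (-j * (θ + s * Complex.I)) * stepMult d (θ + s * Complex.I) ^ N) : ℂ)‖
      = Real.exp (-t) * (t ^ N / N !) *
        (Real.exp (-j * θ) * ‖stepMult d (θ + s * Complex.I)‖ ^ N) := by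
        simp only [norm_mul, norm_div, norm_pow, Complex.norm_exp, hre, Complex.norm_natCast,
          Complex.norm_of_nonneg ht, Complex.norm_of_nonneg (Real.exp_pos _).le]
    _ ≤ Real.exp (-t) * (t ^ N / N !) * (Real.exp (-j * θ) * C ^ N) := by
        gcongr
        exact hC s (Set.uIoc_subset_uIcc hs)
    _ = Real.exp (-t) * Real.exp (-j * θ) * ((t * C) ^ N / N !) := by
        rw [mul_pow]; ring

end Fourier

section LocalLimit

lemma norm_cosh_sub_le {w : ℂ} (hw : ‖w‖ ≤ 1) : ‖Complex.cosh w - 1 - w ^ 2 / 2‖ ≤ ‖w‖ ^ 4 := by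
  have hexp {z : ℂ} (hz : ‖z‖ ≤ 1) :
      ‖Complex.exp z - (1 + z + z ^ 2 / 2 + z ^ 3 / 6)‖ ≤ ‖z‖ ^ 4 := by
    have hbound := (Complex.exp_bound hz (n := 4) (by norm_num)).trans
      (mul_le_of_le_one_right (by positivity) (by norm_num [Nat.factorial]))
    simpa [Finset.sum_range_succ, Nat.factorial] using hbound
  calc ‖Complex.cosh w - 1 - w ^ 2 / 2‖
      = ‖(Complex.exp w - (1 + w + w ^ 2 / 2 + w ^ 3 / 6)) +
          (Complex.exp (-w) - (1 + -w + (-w) ^ 2 / 2 + (-w) ^ 3 / 6))‖ / 2 := by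
        rw [← Complex.norm_two, ← norm_div, Complex.cosh]
        ring_nf
    _ ≤ (‖w‖ ^ 4 + ‖w‖ ^ 4) / 2 := by
        have hneg : ‖-w‖ ≤ 1 := (norm_neg w).trans_le hw
        gcongr
        exact (norm_add_le _ _).trans
          (add_le_add (hexp hw) ((hexp hneg).trans_eq (by rw [norm_neg])))
    _ = ‖w‖ ^ 4 := by ring

lemma tendsto_mul_cosh_sub {ι : Type*} {l : Filter ι} {τ : ι → ℝ} {w : ι → ℂ}
    (hτ : Tendsto τ l atTop) (hw : Tendsto (fun i => τ i * ‖w i‖ ^ 4) l (𝓝 0)) :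
    Tendsto (fun i => τ i * (Complex.cosh (w i) - 1 - w i ^ 2 / 2)) l (𝓝 0) := by
  refine squeeze_zero_norm' ?_ hw
  filter_upwards [hτ.eventually_ge_atTop 1, hw.eventually (gt_mem_nhds one_pos)] with i hi hwi
  have hsmall : ‖w i‖ ≤ 1 := by
    by_contra! hlarge
    exact hwi.not_ge (one_le_mul_of_one_le_of_one_le hi (one_le_pow₀ hlarge.le))
  rw [norm_mul, Complex.norm_of_nonneg (by linarith)]
  gcongr
  exact norm_cosh_sub_le hsmall

/-- The integrand of the Fourier inversion formula for the heat kernel along the line of real part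
`θ`, rescaled diffusively (`y = √τ s`) and divided by its value at `y = 0`. -/
def tiltedIntegrand (τ θ : ℝ) (j : ℤ) : ℝ → ℂ :=
  (Set.Ioc (-(Real.pi * √τ)) (Real.pi * √τ)).indicator fun y =>
    Complex.exp (τ * (Complex.cosh (θ + (y / √τ : ℝ) * Complex.I) - Complex.cosh θ) -
      j * ((y / √τ : ℝ) * Complex.I))

lemma sqrt_mul_heatKernel_mul_two_pi {d : ℕ} {t : ℝ} (ht : 0 < t / d) (j : ℤ) (θ : ℝ) :
    ((√(t / d) * heatKernel d t j : ℝ) : ℂ) * (2 * Real.pi) =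
      (Real.exp (t / d * (Real.cosh θ - 1) - j * θ) : ℝ) * ∫ y, tiltedIntegrand (t / d) θ j y := by
  have hs : 0 < √(t / d) := Real.sqrt_pos.2 ht
  have ht0 : 0 ≤ t := by
    by_contra! h
    exact ht.not_ge (div_nonpos_of_nonpos_of_nonneg h.le d.cast_nonneg)
  have hsubst := intervalIntegral.integral_comp_div (a := -(Real.pi * √(t / d)))
    (b := Real.pi * √(t / d)) (fun s : ℝ => Complex.exp ((t / d : ℝ) *
      (Complex.cosh (θ + s * Complex.I) - 1) - j * (θ + s * Complex.I))) hs.ne'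
  rw [neg_div, mul_div_cancel_right₀ _ hs.ne', ← heatKernel_mul_two_pi ht0] at hsubst
  have hle : -(Real.pi * √(t / d)) ≤ Real.pi * √(t / d) := neg_le_self (by positivity)
  rw [Complex.ofReal_mul, mul_assoc, ← Complex.real_smul, ← hsubst,
    intervalIntegral.integral_of_le hle, ← integral_indicator measurableSet_Ioc,
    ← integral_const_mul]
  congr 1 with y
  rw [tiltedIntegrand, ← Set.indicator_const_mul]
  congr 1 with y
  rw [Complex.ofReal_exp, ← Complex.exp_add]
  push_cast
  ring_nf

lemma norm_tiltedIntegrand_le {τ : ℝ} (hτ : 0 < τ) (θ : ℝ) (j : ℤ) (y : ℝ) :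
    ‖tiltedIntegrand τ θ j y‖ ≤ Real.exp (-(2 / Real.pi ^ 2) * y ^ 2) := by
  have hs : 0 < √τ := Real.sqrt_pos.2 hτ
  by_cases hy : y ∈ Set.Ioc (-(Real.pi * √τ)) (Real.pi * √τ)
  swap
  · rw [tiltedIntegrand, Set.indicator_of_notMem hy, norm_zero]
    positivity
  have habs : |y / √τ| ≤ Real.pi := by
    rw [abs_div, abs_of_pos hs, div_le_iff₀ hs]
    exact abs_le.2 ⟨hy.1.le, hy.2⟩
  have hre (s : ℝ) : ((τ : ℂ) * (Complex.cosh (θ + s * Complex.I) - Complex.cosh θ) -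
      j * (s * Complex.I)).re = -(τ * (Real.cosh θ * (1 - Real.cos s))) := by
    rw [Complex.cosh_add, Complex.cosh_mul_I, Complex.sinh_mul_I]
    simp [Complex.cos_ofReal_re]
    ring
  rw [tiltedIntegrand, Set.indicator_of_mem hy, Complex.norm_exp, hre, Real.exp_le_exp, neg_mul,
    neg_le_neg_iff]
  calc 2 / Real.pi ^ 2 * y ^ 2 = τ * (1 * (2 / Real.pi ^ 2 * (y / √τ) ^ 2)) := by
        rw [div_pow, Real.sq_sqrt hτ.le]
        field_simp
    _ ≤ τ * (Real.cosh θ * (1 - Real.cos (y / √τ))) := by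
        gcongr
        · exact Real.one_le_cosh θ
        · linarith [Real.cos_le_one_sub_mul_cos_sq habs]

lemma integrable_exp_neg_two_div_pi_sq_mul_sq :
    Integrable fun y : ℝ => Real.exp (-(2 / Real.pi ^ 2) * y ^ 2) :=
  integrable_exp_neg_mul_sq (by positivity)

lemma sqrt_mul_heatKernel_le {d : ℕ} {t : ℝ} (ht : 0 < t / d) (j : ℤ) (θ : ℝ) :
    √(t / d) * heatKernel d t j ≤ Real.exp (t / d * (Real.cosh θ - 1) - j * θ) := by
  have hintegral : ‖∫ y, tiltedIntegrand (t / d) θ j y‖ ≤ 2 * Real.pi :=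
    calc ‖∫ y, tiltedIntegrand (t / d) θ j y‖
        ≤ ∫ y : ℝ, Real.exp (-(2 / Real.pi ^ 2) * y ^ 2) :=
          norm_integral_le_of_norm_le integrable_exp_neg_two_div_pi_sq_mul_sq
            (Eventually.of_forall (norm_tiltedIntegrand_le ht θ j))
      _ = √(Real.pi / (2 / Real.pi ^ 2)) := integral_gaussian _
      _ ≤ 2 * Real.pi := by
          rw [Real.sqrt_le_left (by positivity)]
          field_simp
          nlinarith [Real.pi_lt_four]
  have hnorm := congrArg norm (sqrt_mul_heatKernel_mul_two_pi ht j θ)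
  simp only [norm_mul, Complex.norm_two, Complex.norm_real, Real.norm_of_nonneg Real.pi_pos.le,
    Real.norm_of_nonneg (Real.exp_pos _).le] at hnorm
  refine (Real.le_norm_self _).trans (le_of_mul_le_mul_right ?_ Real.two_pi_pos)
  rw [norm_mul, hnorm]
  gcongr

lemma tilted_exponent_eq {τ : ℝ} (hτ : 0 < τ) (θ y : ℝ) (j : ℤ) :
    (τ * (Complex.cosh (θ + (y / √τ : ℝ) * Complex.I) - Complex.cosh θ) -
      j * ((y / √τ : ℝ) * Complex.I) : ℂ) =
    τ * (Complex.cosh (θ + (y / √τ : ℝ) * Complex.I) - 1 - (θ + (y / √τ : ℝ) * Complex.I) ^ 2 / 2) -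
      τ * (Complex.cosh θ - 1 - (θ : ℂ) ^ 2 / 2) -
      ((j - τ * θ) / √τ : ℝ) * (y * Complex.I) + (-(y ^ 2 / 2) : ℝ) := by
  have hs : ((√τ : ℝ) : ℂ) ≠ 0 := by exact_mod_cast (Real.sqrt_pos.2 hτ).ne'
  have hsq : (τ : ℂ) = (√τ : ℝ) ^ 2 := by exact_mod_cast (Real.sq_sqrt hτ.le).symm
  have hcross : (τ : ℂ) * (y / √τ : ℝ) ^ 2 = y ^ 2 := by
    push_cast
    rw [hsq]
    field_simp
  have hlinear : (τ : ℂ) * (y / √τ : ℝ) = √τ * y := by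
    push_cast
    rw [hsq]
    field_simp
  have hshift : (((j - τ * θ) / √τ : ℝ) : ℂ) * y = j * (y / √τ : ℝ) - √τ * y * θ := by
    push_cast
    rw [hsq]
    field_simp
  have hgauss : ((-(y ^ 2 / 2) : ℝ) : ℂ) = -(y ^ 2 / 2) := by push_cast; ring
  rw [hgauss]
  linear_combination Complex.I ^ 2 / 2 * hcross + Complex.I * hshift + θ * Complex.I * hlinear +
    y ^ 2 / 2 * Complex.I_sq

lemma tendsto_mul_norm_add_div_sqrt_pow_four {ι : Type*} {l : Filter ι} {τ θ : ι → ℝ}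
    (hτ : Tendsto τ l atTop) (hθ : Tendsto (fun i => τ i * θ i ^ 4) l (𝓝 0)) (y : ℝ) :
    Tendsto (fun i => τ i * ‖(θ i + (y / √(τ i) : ℝ) * Complex.I : ℂ)‖ ^ 4) l (𝓝 0) := by
  have hnorm (i : ι) : ‖(θ i + (y / √(τ i) : ℝ) * Complex.I : ℂ)‖ ^ 4 =
      (θ i ^ 2 + (y / √(τ i)) ^ 2) ^ 2 := by
    rw [← Complex.normSq_add_mul_I, ← Complex.sq_norm]
    ring
  have hbound : Tendsto (fun i => 2 * (τ i * θ i ^ 4) + 2 * y ^ 4 * (τ i)⁻¹) l (𝓝 0) := by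
    simpa using (hθ.const_mul 2).add ((tendsto_inv_atTop_zero.comp hτ).const_mul (2 * y ^ 4))
  refine squeeze_zero' ?_ ?_ hbound <;> filter_upwards [hτ.eventually_gt_atTop 0] with i hi
  · positivity
  · calc τ i * ‖(θ i + (y / √(τ i) : ℝ) * Complex.I : ℂ)‖ ^ 4
        ≤ τ i * (2 * ((θ i ^ 2) ^ 2 + ((y / √(τ i)) ^ 2) ^ 2)) := by
          rw [hnorm]
          gcongr
          exact add_sq_le
      _ = 2 * (τ i * θ i ^ 4) + 2 * y ^ 4 * (τ i)⁻¹ := by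
          rw [div_pow, Real.sq_sqrt hi.le]
          field_simp

lemma tendsto_tiltedIntegrand {ι : Type*} {l : Filter ι} {τ θ : ι → ℝ} {j : ι → ℤ}
    (hτ : Tendsto τ l atTop) (hθ : Tendsto (fun i => τ i * θ i ^ 4) l (𝓝 0))
    (hj : Tendsto (fun i => (j i - τ i * θ i) / √(τ i)) l (𝓝 0)) (y : ℝ) :
    Tendsto (fun i => tiltedIntegrand (τ i) (θ i) (j i) y) l
      (𝓝 (Complex.exp (-(y ^ 2 / 2) : ℝ))) := by
  have hθ' : Tendsto (fun i => τ i * ‖(θ i : ℂ)‖ ^ 4) l (𝓝 0) := by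
    simpa using tendsto_mul_norm_add_div_sqrt_pow_four hτ hθ 0
  have hj' := (Complex.continuous_ofReal.tendsto' 0 0 Complex.ofReal_zero).comp hj
  have hexponent := (((tendsto_mul_cosh_sub hτ (tendsto_mul_norm_add_div_sqrt_pow_four hτ hθ y)).sub
    (tendsto_mul_cosh_sub hτ hθ')).sub (hj'.mul_const (y * Complex.I))).add_const
      ((-(y ^ 2 / 2) : ℝ) : ℂ)
  rw [sub_zero, zero_mul, sub_zero, zero_add] at hexponent
  have hrange : ∀ᶠ i in l, |y| < Real.pi * √(τ i) :=
    ((Real.tendsto_sqrt_atTop.comp hτ).const_mul_atTop Real.pi_pos).eventually_gt_atTop _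
  refine ((Complex.continuous_exp.tendsto _).comp hexponent).congr' ?_
  filter_upwards [hτ.eventually_gt_atTop 0, hrange] with i hi hy
  have hmem : y ∈ Set.Ioc (-(Real.pi * √(τ i))) (Real.pi * √(τ i)) :=
    ⟨(abs_lt.1 hy).1, (abs_lt.1 hy).2.le⟩
  rw [tiltedIntegrand, Set.indicator_of_mem hmem, tilted_exponent_eq hi]
  rfl

lemma tendsto_integral_tiltedIntegrand {ι : Type*} {l : Filter ι} [l.IsCountablyGenerated]
    {τ θ : ι → ℝ} {j : ι → ℤ} (hτ : Tendsto τ l atTop)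
    (hθ : Tendsto (fun i => τ i * θ i ^ 4) l (𝓝 0))
    (hj : Tendsto (fun i => (j i - τ i * θ i) / √(τ i)) l (𝓝 0)) :
    Tendsto (fun i => ∫ y, tiltedIntegrand (τ i) (θ i) (j i) y) l (𝓝 (√(2 * Real.pi) : ℝ)) := by
  have hgauss : ∫ y : ℝ, Complex.exp ((-(y ^ 2 / 2) : ℝ)) = (√(2 * Real.pi) : ℝ) := by
    simp only [← Complex.ofReal_exp, integral_complex_ofReal]
    congr 1
    calc ∫ y : ℝ, Real.exp (-(y ^ 2 / 2)) = ∫ y : ℝ, Real.exp (-(1 / 2) * y ^ 2) := by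
          congr with y
          ring_nf
      _ = √(2 * Real.pi) := by
          rw [integral_gaussian]
          ring_nf
  rw [← hgauss]
  refine tendsto_integral_filter_of_dominated_convergence _
    (Eventually.of_forall fun i => ?_) ?_ integrable_exp_neg_two_div_pi_sq_mul_sq
    (Eventually.of_forall (tendsto_tiltedIntegrand hτ hθ hj))
  · exact Measurable.aestronglyMeasurable (Measurable.indicator (by fun_prop) measurableSet_Ioc)
  · filter_upwards [hτ.eventually_gt_atTop 0] with i hi
    exact Eventually.of_forall (norm_tiltedIntegrand_le hi (θ i) (j i))

lemma tendsto_sqrt_mul_exp_mul_heatKernel {ι : Type*} {l : Filter ι} [l.IsCountablyGenerated]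
    {d : ℕ} {t θ : ι → ℝ} {j : ι → ℤ} (hτ : Tendsto (fun i => t i / d) l atTop)
    (hθ : Tendsto (fun i => t i / d * θ i ^ 4) l (𝓝 0))
    (hj : Tendsto (fun i => (j i - t i / d * θ i) / √(t i / d)) l (𝓝 0)) :
    Tendsto (fun i => √(t i / d) * Real.exp (j i * θ i - t i / d * θ i ^ 2 / 2) *
      heatKernel d (t i) (j i)) l (𝓝 (√(2 * Real.pi))⁻¹) := by
  have hθ' : Tendsto (fun i => t i / d * ‖(θ i : ℂ)‖ ^ 4) l (𝓝 0) := by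
    simpa using tendsto_mul_norm_add_div_sqrt_pow_four hτ hθ 0
  have hlim := ((((Complex.continuous_exp.tendsto 0).comp (tendsto_mul_cosh_sub hτ hθ')).mul
    (tendsto_integral_tiltedIntegrand hτ hθ hj)).div_const ((2 * Real.pi : ℝ) : ℂ))
  have hval : Complex.exp 0 * (√(2 * Real.pi) : ℝ) / (2 * Real.pi : ℝ) =
      (((√(2 * Real.pi))⁻¹ : ℝ) : ℂ) := by
    rw [Complex.exp_zero, one_mul, ← Complex.ofReal_div, Real.sqrt_div_self]
  rw [hval] at hlim
  refine tendsto_ofReal_iff.1 (hlim.congr' ?_)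
  filter_upwards [hτ.eventually_gt_atTop 0] with i hi
  have hinv := sqrt_mul_heatKernel_mul_two_pi hi (j i) (θ i)
  have hexp : (Real.exp (j i * θ i - t i / d * θ i ^ 2 / 2) : ℂ) *
      (Real.exp (t i / d * (Real.cosh (θ i) - 1) - j i * θ i) : ℝ) =
      Complex.exp ((t i / d : ℝ) * (Complex.cosh (θ i) - 1 - (θ i : ℂ) ^ 2 / 2)) := by
    rw [← Complex.ofReal_mul, ← Real.exp_add, Complex.ofReal_exp]
    push_cast
    ring_nf
  have hpi : ((2 * Real.pi : ℝ) : ℂ) ≠ 0 := by exact_mod_cast Real.two_pi_pos.ne'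
  rw [div_eq_iff hpi, Function.comp, ← hexp, mul_assoc, ← hinv]
  push_cast
  ring

end LocalLimit

section Scales

variable {d : ℕ} {β t : ℝ}

lemma aScale_eq (β : ℝ) (ht : 1 < t) :
    aScale β t = Real.log t - Real.log (2 * Real.pi) / (2 * β) -
      (β + 1) / (2 * β) * Real.log (Real.log t) := by
  have hlog : 0 < Real.log t := Real.log_pos ht
  rw [aScale, Real.log_div (by positivity) (by positivity),
    Real.log_mul (by positivity) (by positivity), Real.log_rpow (by positivity),
    Real.log_rpow hlog]
  ring

lemma bScale_sq (hβ : 0 < β) (ht : 1 < t) : bScale d β t ^ 2 = β * t / (d * Real.log t) := by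
  have hlog : 0 < Real.log t := Real.log_pos ht
  rw [bScale, Real.sq_sqrt (by positivity)]

variable [NeZero d]

lemma bScale_pos (hβ : 0 < β) (ht : 1 < t) : 0 < bScale d β t := by
  have hlog : 0 < Real.log t := Real.log_pos ht
  have hd : (0 : ℝ) < d := by exact_mod_cast NeZero.pos d
  exact Real.sqrt_pos.2 (by positivity)

lemma tendsto_bScale (hβ : 0 < β) : Tendsto (bScale d β) atTop atTop := by
  have hd : (0 : ℝ) < d := by exact_mod_cast NeZero.pos d
  have hratio : Tendsto (fun t : ℝ => (Real.log t / t)⁻¹) atTop atTop := by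
    refine tendsto_inv_nhdsGT_zero.comp (tendsto_nhdsWithin_iff.2 ⟨?_, ?_⟩)
    · simpa using Real.tendsto_pow_log_div_mul_add_atTop 1 0 1 one_ne_zero
    · filter_upwards [eventually_gt_atTop 1] with t ht
      exact div_pos (Real.log_pos ht) (by linarith)
  refine Real.tendsto_sqrt_atTop.comp ((hratio.const_mul_atTop (div_pos hβ hd)).congr fun t => ?_)
  rw [inv_div, div_mul_div_comm]

lemma bScale_div_sqrt (hβ : 0 < β) (ht : 1 < t) :
    bScale d β t / √(t / d) = √β / √(Real.log t) := by
  have hlog : 0 < Real.log t := Real.log_pos ht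
  have hd : (0 : ℝ) < d := by exact_mod_cast NeZero.pos d
  rw [bScale, ← Real.sqrt_div (by positivity), ← Real.sqrt_div hβ.le]
  congr 1
  field_simp

lemma tendsto_aScale_sub_log_div_sqrt_log (β : ℝ) :
    Tendsto (fun t => (aScale β t - Real.log t) / √(Real.log t)) atTop (𝓝 0) := by
  have hinv : Tendsto (fun u : ℝ => (√u)⁻¹) atTop (𝓝 0) :=
    tendsto_inv_atTop_zero.comp Real.tendsto_sqrt_atTop
  have hlog : Tendsto (fun u : ℝ => Real.log u / √u) atTop (𝓝 0) := by
    simpa only [Real.sqrt_eq_rpow] using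
      (isLittleO_log_rpow_atTop (r := 1 / 2) (by norm_num)).tendsto_div_nhds_zero
  have hlim := ((hinv.const_mul (-(Real.log (2 * Real.pi) / (2 * β)))).sub
    (hlog.const_mul ((β + 1) / (2 * β)))).comp Real.tendsto_log_atTop
  rw [mul_zero, mul_zero, sub_zero] at hlim
  refine hlim.congr' ?_
  filter_upwards [eventually_gt_atTop 1] with t ht
  rw [aScale_eq β ht, Function.comp]
  ring

/-- The exponential tilt under which a level of order `b_t log t` becomes typical for the first
coordinate of the walk at time `t`. -/
def tilt (d : ℕ) (β t : ℝ) : ℝ := β / bScale d β t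

lemma mul_tilt (hβ : 0 < β) (ht : 1 < t) : t / d * tilt d β t = bScale d β t * Real.log t := by
  have hlog : 0 < Real.log t := Real.log_pos ht
  have hd : (0 : ℝ) < d := by exact_mod_cast NeZero.pos d
  have hb : 0 < bScale d β t := bScale_pos hβ ht
  have hsq := bScale_sq (d := d) hβ ht
  rw [tilt, mul_div_assoc', div_eq_iff hb.ne', mul_right_comm, ← sq, hsq]
  field_simp

lemma mul_tilt_sq (hβ : 0 < β) (ht : 1 < t) : t / d * tilt d β t ^ 2 = β * Real.log t := by
  have hb : 0 < bScale d β t := bScale_pos hβ ht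
  rw [sq, ← mul_assoc, mul_tilt hβ ht, tilt]
  field_simp

lemma tendsto_mul_tilt_pow_four (hβ : 0 < β) :
    Tendsto (fun t => t / d * tilt d β t ^ 4) atTop (𝓝 0) := by
  have hd : (0 : ℝ) < d := by exact_mod_cast NeZero.pos d
  have hlim := (Real.tendsto_pow_log_div_mul_add_atTop 1 0 2 one_ne_zero).const_mul (β ^ 2 * d)
  simp only [one_mul, add_zero, mul_zero] at hlim
  refine hlim.congr' ?_
  filter_upwards [eventually_gt_atTop 1] with t ht
  have : 0 < t := by linarith
  calc β ^ 2 * d * (Real.log t ^ 2 / t) = (β * Real.log t) ^ 2 / (t / d) := by field_simp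
    _ = t / d * tilt d β t ^ 4 := by
        rw [← mul_tilt_sq (d := d) hβ ht]
        field_simp

lemma bScale_rpow_mul_exp_tilt (hβ : 0 < β) (ht : 1 < t) (s : ℝ) :
    bScale d β t ^ (β + 1) / √(t / d) * Real.exp (t / d * tilt d β t ^ 2 / 2 - s * tilt d β t) =
      β ^ ((β + 1) / 2) / d ^ (β / 2) * √(2 * Real.pi) *
        Real.exp (-(β * (s / bScale d β t - aScale β t))) := by
  have hlog : 0 < Real.log t := Real.log_pos ht
  have ht0 : 0 < t := by linarith
  have hd : (0 : ℝ) < d := by exact_mod_cast NeZero.pos d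
  have hb : 0 < bScale d β t := bScale_pos hβ ht
  have hlogb : Real.log (bScale d β t) =
      1 / 2 * (Real.log β + Real.log t - Real.log d - Real.log (Real.log t)) := by
    rw [bScale, Real.log_sqrt (by positivity), Real.log_div (by positivity) (by positivity),
      Real.log_mul (by positivity) (by positivity), Real.log_mul (by positivity) (by positivity)]
    ring
  have hexponent : β * aScale β t = β * Real.log t - 1 / 2 * Real.log (2 * Real.pi) -
      (β + 1) / 2 * Real.log (Real.log t) := by
    rw [aScale_eq β ht]
    field_simp
  rw [mul_tilt_sq hβ ht, tilt, Real.sqrt_eq_rpow, Real.sqrt_eq_rpow, Real.rpow_def_of_pos hb,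
    Real.rpow_def_of_pos hβ, Real.rpow_def_of_pos hd, Real.rpow_def_of_pos Real.two_pi_pos,
    Real.rpow_def_of_pos (by positivity : 0 < t / d), Real.log_div ht0.ne' hd.ne', hlogb]
  simp only [← Real.exp_add, ← Real.exp_sub]
  congr 1
  linear_combination -hexponent

lemma bScale_rpow_mul_heatKernel_eq (hβ : 0 < β) (ht : 1 < t) (j : ℤ) :
    bScale d β t ^ (β + 1) * heatKernel d t j =
      β ^ ((β + 1) / 2) / d ^ (β / 2) * √(2 * Real.pi) *
        Real.exp (-(β * (j / bScale d β t - aScale β t))) *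
      (√(t / d) * Real.exp (j * tilt d β t - t / d * tilt d β t ^ 2 / 2) * heatKernel d t j) := by
  have hd : (0 : ℝ) < d := by exact_mod_cast NeZero.pos d
  have : 0 < √(t / d) := Real.sqrt_pos.2 (div_pos (by linarith) hd)
  rw [← bScale_rpow_mul_exp_tilt hβ ht, ← neg_sub (t / d * tilt d β t ^ 2 / 2), Real.exp_neg]
  field_simp

lemma tendsto_bScale_rpow_mul_heatKernel (hβ : 0 < β) {j : ℝ → ℤ} {y : ℝ}
    (hj : Tendsto (fun t => j t / bScale d β t - aScale β t) atTop (𝓝 y)) :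
    Tendsto (fun t => bScale d β t ^ (β + 1) * heatKernel d t (j t)) atTop
      (𝓝 (β ^ ((β + 1) / 2) / d ^ (β / 2) * Real.exp (-(β * y)))) := by
  have hd : (0 : ℝ) < d := by exact_mod_cast NeZero.pos d
  have hinv : Tendsto (fun t => (√(Real.log t))⁻¹) atTop (𝓝 0) :=
    tendsto_inv_atTop_zero.comp (Real.tendsto_sqrt_atTop.comp Real.tendsto_log_atTop)
  have hcentre : Tendsto (fun t => (j t - t / d * tilt d β t) / √(t / d)) atTop (𝓝 0) := by
    have hlim := ((hj.mul hinv).add (tendsto_aScale_sub_log_div_sqrt_log β)).const_mul √β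
    rw [mul_zero, add_zero, mul_zero] at hlim
    refine hlim.congr' ?_
    filter_upwards [eventually_gt_atTop 1] with t ht
    have hb : 0 < bScale d β t := bScale_pos hβ ht
    rw [mul_tilt hβ ht]
    calc √β * ((j t / bScale d β t - aScale β t) * (√(Real.log t))⁻¹ +
          (aScale β t - Real.log t) / √(Real.log t))
        = √β / √(Real.log t) * (j t / bScale d β t - Real.log t) := by ring
      _ = (j t - bScale d β t * Real.log t) / √(t / d) := by
          rw [← bScale_div_sqrt (d := d) hβ ht]
          field_simp
  have hexp := (Real.continuous_exp.tendsto _).comp (hj.const_mul β).neg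
  have hlim := (hexp.const_mul (β ^ ((β + 1) / 2) / d ^ (β / 2) * √(2 * Real.pi))).mul
    (tendsto_sqrt_mul_exp_mul_heatKernel (tendsto_id.atTop_div_const hd)
      (tendsto_mul_tilt_pow_four hβ) hcentre)
  have hval (E : ℝ) : β ^ ((β + 1) / 2) / d ^ (β / 2) * √(2 * Real.pi) * E * (√(2 * Real.pi))⁻¹ =
      β ^ ((β + 1) / 2) / d ^ (β / 2) * E := by
    have hpi : √(2 * Real.pi) ≠ 0 := (Real.sqrt_pos.2 Real.two_pi_pos).ne'
    field_simp
  rw [hval] at hlim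
  refine hlim.congr' ?_
  filter_upwards [eventually_gt_atTop 1] with t ht
  exact (bScale_rpow_mul_heatKernel_eq hβ ht (j t)).symm

lemma exists_bScale_rpow_mul_heatKernel_le (hβ : 0 < β) : ∃ C, 0 < C ∧ ∀ᶠ t in atTop, ∀ j : ℤ,
    bScale d β t ^ (β + 1) * heatKernel d t j ≤
      C * Real.exp (-(β * (j / bScale d β t - aScale β t))) := by
  have hd : (0 : ℝ) < d := by exact_mod_cast NeZero.pos d
  have hcosh : Tendsto (fun t => t / d * (Real.cosh (tilt d β t) - 1 - tilt d β t ^ 2 / 2)) atTop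
      (𝓝 0) := by
    refine tendsto_ofReal_iff.1 ?_
    simpa using tendsto_mul_cosh_sub (tendsto_id.atTop_div_const hd)
      (w := fun t => (tilt d β t : ℂ))
      (by simpa [(by decide : Even 4).pow_abs] using tendsto_mul_tilt_pow_four (d := d) hβ)
  refine ⟨β ^ ((β + 1) / 2) / d ^ (β / 2) * √(2 * Real.pi) * Real.exp 1, by positivity, ?_⟩
  filter_upwards [eventually_gt_atTop 1, hcosh.eventually (gt_mem_nhds one_pos)] with t ht hone j
  have hchernoff := sqrt_mul_heatKernel_le (div_pos (by linarith) hd : 0 < t / d) j (tilt d β t)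
  rw [bScale_rpow_mul_heatKernel_eq hβ ht, mul_right_comm]
  gcongr
  calc √(t / d) * Real.exp (j * tilt d β t - t / d * tilt d β t ^ 2 / 2) * heatKernel d t j
      = Real.exp (j * tilt d β t - t / d * tilt d β t ^ 2 / 2) * (√(t / d) * heatKernel d t j) := by
        ring
    _ ≤ Real.exp (j * tilt d β t - t / d * tilt d β t ^ 2 / 2) *
        Real.exp (t / d * (Real.cosh (tilt d β t) - 1) - j * tilt d β t) := by gcongr
    _ = Real.exp (t / d * (Real.cosh (tilt d β t) - 1 - tilt d β t ^ 2 / 2)) := by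
        rw [← Real.exp_add]
        ring_nf
    _ ≤ Real.exp 1 := Real.exp_le_exp.2 hone.le

end Scales

section RiemannSum

variable {b : ℝ}

lemma preimage_floor_mul_inter_Ici (hb : 0 < b) (j : ℕ) :
    (fun v : ℝ => ⌊v * b⌋₊) ⁻¹' {j} ∩ Set.Ici 0 = Set.Ico (j / b : ℝ) ((j + 1) / b) := by
  ext v
  simp only [Set.mem_inter_iff, Set.mem_preimage, Set.mem_singleton_iff, Set.mem_Ici, Set.mem_Ico,
    div_le_iff₀ hb, lt_div_iff₀ hb]
  constructor
  · rintro ⟨hj, hv⟩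
    exact (Nat.floor_eq_iff (mul_nonneg hv hb.le)).1 hj
  · rintro ⟨hj, hj'⟩
    have hvb : 0 ≤ v * b := j.cast_nonneg.trans hj
    exact ⟨(Nat.floor_eq_iff hvb).2 ⟨hj, hj'⟩, nonneg_of_mul_nonneg_left hvb hb⟩

lemma tsum_eq_lintegral_floor (hb : 0 < b) (f : ℕ → ℝ≥0∞) :
    ∑' j, f j = ∫⁻ v in Set.Ioi (0 : ℝ), ENNReal.ofReal b * f ⌊v * b⌋₊ := by
  have hfloor : Measurable fun v : ℝ => ⌊v * b⌋₊ :=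
    Nat.measurable_floor.comp (measurable_id.mul_const b)
  rw [Measure.restrict_congr_set Ioi_ae_eq_Ici,
    ← lintegral_map (g := fun v : ℝ => ⌊v * b⌋₊) (f := fun j => ENNReal.ofReal b * f j)
      (measurable_of_countable _) hfloor, lintegral_countable']
  refine tsum_congr fun j => ?_
  rw [Measure.map_apply hfloor (measurableSet_singleton j),
    Measure.restrict_apply (hfloor (measurableSet_singleton j)), preimage_floor_mul_inter_Ici hb,
    Real.volume_Ico, mul_right_comm, ← ENNReal.ofReal_mul hb.le, ← sub_div, add_sub_cancel_left,
    mul_one_div_cancel hb.ne', ENNReal.ofReal_one, one_mul]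

/-- Lebesgue measure on the open positive quadrant. -/
def quadrantVolume : Measure (ℝ × ℝ) :=
  (volume.restrict (Set.Ioi 0)).prod (volume.restrict (Set.Ioi 0))

lemma ae_quadrantVolume_pos : ∀ᵐ p ∂quadrantVolume, 0 < p.1 ∧ 0 < p.2 := by
  rw [quadrantVolume, Measure.prod_restrict]
  exact ae_restrict_mem (measurableSet_Ioi.prod measurableSet_Ioi)

lemma measurable_comp_floor_mul {α : Type*} [MeasurableSpace α] (b : ℝ) (f : ℕ → ℕ → α) :
    Measurable fun p : ℝ × ℝ => f ⌊p.1 * b⌋₊ ⌊p.2 * b⌋₊ :=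
  (measurable_of_countable fun q : ℕ × ℕ => f q.1 q.2).comp
    ((Nat.measurable_floor.comp (measurable_fst.mul_const b)).prodMk
      (Nat.measurable_floor.comp (measurable_snd.mul_const b)))

lemma tsum_tsum_eq_lintegral_floor (hb : 0 < b) (f : ℕ → ℕ → ℝ≥0∞) :
    ∑' j, ∑' u, f j u =
      ∫⁻ p, ENNReal.ofReal (b ^ 2) * f ⌊p.1 * b⌋₊ ⌊p.2 * b⌋₊ ∂quadrantVolume := by
  rw [quadrantVolume, lintegral_prod _ ((measurable_comp_floor_mul b f).const_mul _).aemeasurable,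
    tsum_eq_lintegral_floor hb]
  refine lintegral_congr fun v => ?_
  rw [tsum_eq_lintegral_floor hb, ← lintegral_const_mul' _ _ ENNReal.ofReal_ne_top]
  refine lintegral_congr fun w => ?_
  rw [← mul_assoc, ← ENNReal.ofReal_mul hb.le, sq]

end RiemannSum

section RegularGrowth

variable {s K : ℝ} {G : ℕ → ℝ}

lemma exists_le_mul_one_add_rpow
    (hG : Tendsto (fun u : ℕ => G u / (u : ℝ) ^ s) atTop (𝓝 K)) :
    ∃ C, 0 ≤ C ∧ ∀ u : ℕ, G u ≤ C * (1 + u : ℝ) ^ s := by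
  have hratio : Tendsto (fun u : ℕ => (u / (u + 1) : ℝ) ^ s) atTop (𝓝 1) := by
    simpa using (tendsto_natCast_div_add_atTop (1 : ℝ)).rpow_const (p := s) (.inl one_ne_zero)
  obtain ⟨C, hC⟩ := ((hG.mul hratio).congr' (f₂ := fun u : ℕ => G u / (1 + u : ℝ) ^ s) <| by
    filter_upwards [eventually_gt_atTop 0] with u hu
    have : (0 : ℝ) < (u : ℝ) ^ s := by positivity
    rw [Real.div_rpow (by positivity) (by positivity), add_comm 1 (u : ℝ)]
    field_simp).bddAbove_range
  refine ⟨max C 0, le_max_right _ _, fun u => ?_⟩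
  rw [← div_le_iff₀ (by positivity)]
  exact (hC ⟨u, rfl⟩).trans (le_max_left _ _)

lemma tendsto_comp_floor_mul_div_rpow
    (hG : Tendsto (fun u : ℕ => G u / (u : ℝ) ^ s) atTop (𝓝 K)) {w : ℝ} (hw : 0 < w) :
    Tendsto (fun b : ℝ => G ⌊w * b⌋₊ / b ^ s) atTop (𝓝 (K * w ^ s)) := by
  have hfloor : Tendsto (fun b : ℝ => ⌊w * b⌋₊) atTop atTop :=
    tendsto_nat_floor_atTop.comp (tendsto_id.const_mul_atTop hw)
  have hratio : Tendsto (fun b : ℝ => (⌊w * b⌋₊ / b : ℝ) ^ s) atTop (𝓝 (w ^ s)) :=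
    (tendsto_nat_floor_mul_div_atTop hw.le).rpow_const (.inl hw.ne')
  refine ((hG.comp hfloor).mul hratio).congr' ?_
  filter_upwards [hfloor.eventually_gt_atTop 0, eventually_gt_atTop 0] with b hu hb
  have : (0 : ℝ) < (⌊w * b⌋₊ : ℝ) ^ s := by positivity
  rw [Function.comp, Real.div_rpow (by positivity) hb.le]
  field_simp

lemma one_add_floor_mul_rpow_div_le {w b : ℝ} (hw : 0 < w) (hb : 1 ≤ b) :
    (1 + ⌊w * b⌋₊ : ℝ) ^ s / b ^ s ≤ (2 ^ s + 1) * (1 + w ^ s) := by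
  have hb0 : 0 < b := by linarith
  rw [← Real.div_rpow (by positivity) hb0.le]
  have hws : 0 < w ^ s := by positivity
  have h2s : (0 : ℝ) < 2 ^ s := by positivity
  have hlower : w ≤ (1 + ⌊w * b⌋₊ : ℝ) / b := by
    rw [le_div_iff₀ hb0]
    linarith [Nat.lt_floor_add_one (w * b)]
  have hupper : (1 + ⌊w * b⌋₊ : ℝ) / b ≤ 1 + w := by
    rw [div_le_iff₀ hb0]
    linarith [Nat.floor_le (mul_pos hw hb0).le]
  rcases le_total s 0 with hs | hs
  · have hanti := Real.rpow_le_rpow_of_nonpos hw hlower hs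
    nlinarith
  · have hmono := Real.rpow_le_rpow (by positivity) hupper hs
    rcases le_total w 1 with hw1 | hw1
    · have := Real.rpow_le_rpow (by positivity) (by linarith : 1 + w ≤ 2) hs
      nlinarith
    · have := Real.rpow_le_rpow (by positivity) (by linarith : 1 + w ≤ 2 * w) hs
      rw [Real.mul_rpow zero_le_two hw.le] at this
      nlinarith

end RegularGrowth

section LatticePoint

/-- The lattice point above the level `z` whose distance to `z` is about `b (v + w)`: the summation
index `⌊z⌋ + 1 + j + u` read off from the rescaled coordinates `v ≈ j / b` and `w ≈ u / b`. -/
def latticePoint (z b v w : ℝ) : ℤ := ⌊z⌋ + 1 + (⌊v * b⌋₊ : ℤ) + (⌊w * b⌋₊ : ℤ)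

lemma le_latticePoint_sub (z b v w : ℝ) : (v + w) * b - 2 ≤ latticePoint z b v w - z := by
  have hz := Int.lt_floor_add_one z
  have hv := Nat.lt_floor_add_one (v * b)
  have hw := Nat.lt_floor_add_one (w * b)
  unfold latticePoint
  push_cast
  linarith

lemma tendsto_latticePoint_sub_div {ι : Type*} {l : Filter ι} {b : ι → ℝ} (hb : Tendsto b l atTop)
    (z : ι → ℝ) {v w : ℝ} (hv : 0 ≤ v) (hw : 0 ≤ w) :
    Tendsto (fun i => (latticePoint (z i) (b i) v w - z i) / b i) l (𝓝 (v + w)) := by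
  have hround : Tendsto (fun i => ((⌊z i⌋ : ℝ) + 1 - z i) / b i) l (𝓝 0) := by
    refine tendsto_bdd_div_atTop_nhds_zero (b := 0) (B := 1) (.of_forall fun i => ?_)
      (.of_forall fun i => ?_) hb
    · linarith [Int.lt_floor_add_one (z i)]
    · linarith [Int.floor_le (z i)]
  have hlim := (hround.add ((tendsto_nat_floor_mul_div_atTop hv).comp hb)).add
    ((tendsto_nat_floor_mul_div_atTop hw).comp hb)
  rw [zero_add] at hlim
  refine hlim.congr fun i => ?_
  simp only [latticePoint, Function.comp]
  push_cast
  ring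

end LatticePoint

section MeanNumber

variable {d : ℕ} {β K : ℝ} {G : ℕ → ℝ}

lemma heatKernel_nonneg {t : ℝ} (ht : 0 ≤ t) (j : ℤ) : 0 ≤ heatKernel d t j :=
  tsum_nonneg fun N => mul_nonneg (by positivity) (walkLaw_nonneg N j)

/-- The double sum `∑_{j,u} p_t(⌊z⌋ + 1 + j + u) G(u)` at the level `z = b_t (x + a_t)`, rescaled by
`b_t` in both variables and read as the integral of a step function over the quadrant. -/
def rescaledSummand (d : ℕ) (β : ℝ) (G : ℕ → ℝ) (x t : ℝ) (p : ℝ × ℝ) : ℝ :=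
  bScale d β t ^ 2 *
    (heatKernel d t (latticePoint (level d β x t) (bScale d β t) p.1 p.2) *
      G ⌊p.2 * bScale d β t⌋₊)

lemma measurable_rescaledSummand (d : ℕ) (β : ℝ) (G : ℕ → ℝ) (x t : ℝ) :
    Measurable (rescaledSummand d β G x t) :=
  (measurable_comp_floor_mul (bScale d β t) fun j u =>
    heatKernel d t (⌊level d β x t⌋ + 1 + j + u) * G u).const_mul _

variable [NeZero d]

lemma tsum_tsum_heatKernel_eq_lintegral (hβ : 0 < β) (G : ℕ → ℝ) (x : ℝ) {t : ℝ} (ht : 1 < t) :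
    ∑' (j : ℕ) (u : ℕ), ENNReal.ofReal (heatKernel d t (⌊level d β x t⌋ + 1 + j + u)) *
        ENNReal.ofReal (G u) =
      ∫⁻ p, ENNReal.ofReal (rescaledSummand d β G x t p) ∂quadrantVolume := by
  rw [tsum_tsum_eq_lintegral_floor (bScale_pos (d := d) hβ ht)]
  refine lintegral_congr fun p => ?_
  rw [rescaledSummand, ENNReal.ofReal_mul (by positivity),
    ENNReal.ofReal_mul (heatKernel_nonneg (by linarith) _)]
  rfl

lemma rescaledSummand_eq (hβ : 0 < β) (G : ℕ → ℝ) (x : ℝ) {t : ℝ} (ht : 1 < t) (p : ℝ × ℝ) :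
    rescaledSummand d β G x t p =
      bScale d β t ^ (β + 1) *
          heatKernel d t (latticePoint (level d β x t) (bScale d β t) p.1 p.2) *
        (G ⌊p.2 * bScale d β t⌋₊ / bScale d β t ^ (β - 1)) := by
  have hb : 0 < bScale d β t := bScale_pos hβ ht
  have hpow : bScale d β t ^ (β + 1) = bScale d β t ^ 2 * bScale d β t ^ (β - 1) := by
    rw [← Real.rpow_natCast, ← Real.rpow_add hb]
    ring_nf
  have : 0 < bScale d β t ^ (β - 1) := Real.rpow_pos_of_pos hb _
  rw [rescaledSummand, hpow]
  field_simp

lemma sub_level_div_bScale (hβ : 0 < β) (x s : ℝ) {t : ℝ} (ht : 1 < t) :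
    (s - level d β x t) / bScale d β t + x = s / bScale d β t - aScale β t := by
  have : 0 < bScale d β t := bScale_pos hβ ht
  rw [level]
  field_simp
  ring

lemma tendsto_rescaledSummand (hβ : 0 < β)
    (hG : Tendsto (fun u : ℕ => G u / (u : ℝ) ^ (β - 1)) atTop (𝓝 K)) (x : ℝ) {p : ℝ × ℝ}
    (hp : 0 < p.1 ∧ 0 < p.2) :
    Tendsto (fun t => rescaledSummand d β G x t p) atTop
      (𝓝 (β ^ ((β + 1) / 2) / d ^ (β / 2) * Real.exp (-(β * (p.1 + p.2 + x))) *
        (K * p.2 ^ (β - 1)))) := by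
  have hb := tendsto_bScale (d := d) hβ
  have hlattice := ((tendsto_latticePoint_sub_div hb (level d β x) hp.1.le hp.2.le).add_const
    x).congr' <| by
      filter_upwards [eventually_gt_atTop 1] with t ht
      exact sub_level_div_bScale hβ x _ ht
  refine ((tendsto_bScale_rpow_mul_heatKernel hβ hlattice).mul
    ((tendsto_comp_floor_mul_div_rpow hG hp.2).comp hb)).congr' ?_
  filter_upwards [eventually_gt_atTop 1] with t ht
  exact (rescaledSummand_eq hβ G x ht p).symm

lemma exists_rescaledSummand_le (hβ : 0 < β) (hG₀ : 0 ≤ G)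
    (hG : Tendsto (fun u : ℕ => G u / (u : ℝ) ^ (β - 1)) atTop (𝓝 K)) (x : ℝ) :
    ∃ B, ∀ᶠ t in atTop, ∀ p : ℝ × ℝ, 0 < p.1 ∧ 0 < p.2 → rescaledSummand d β G x t p ≤
      B * (Real.exp (-β * p.1) * ((1 + p.2 ^ (β - 1)) * Real.exp (-β * p.2))) := by
  obtain ⟨C, hC, hCG⟩ := exists_le_mul_one_add_rpow hG
  obtain ⟨A, hA, hAk⟩ := exists_bScale_rpow_mul_heatKernel_le (d := d) hβ
  refine ⟨A * Real.exp (β * (2 - x)) * (C * (2 ^ (β - 1) + 1)), ?_⟩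
  filter_upwards [hAk, eventually_gt_atTop 1, (tendsto_bScale (d := d) hβ).eventually_ge_atTop 1]
    with t hkernel ht hb p hp
  have hb0 : 0 < bScale d β t := by linarith
  set j := latticePoint (level d β x t) (bScale d β t) p.1 p.2
  have hdist : p.1 + p.2 + x - 2 ≤ j / bScale d β t - aScale β t := by
    rw [← sub_level_div_bScale hβ x _ ht, add_sub_right_comm, add_le_add_iff_right,
      le_div_iff₀ hb0]
    linarith [le_latticePoint_sub (level d β x t) (bScale d β t) p.1 p.2]
  have hweight : G ⌊p.2 * bScale d β t⌋₊ / bScale d β t ^ (β - 1) ≤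
      C * ((2 ^ (β - 1) + 1) * (1 + p.2 ^ (β - 1))) := by
    refine le_trans ?_ (mul_le_mul_of_nonneg_left (one_add_floor_mul_rpow_div_le hp.2 hb) hC)
    rw [← mul_div_assoc]
    gcongr
    exact hCG _
  rw [rescaledSummand_eq hβ G x ht]
  calc bScale d β t ^ (β + 1) * heatKernel d t j *
        (G ⌊p.2 * bScale d β t⌋₊ / bScale d β t ^ (β - 1))
      ≤ A * Real.exp (-(β * (p.1 + p.2 + x - 2))) *
          (C * ((2 ^ (β - 1) + 1) * (1 + p.2 ^ (β - 1)))) := by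
        refine mul_le_mul ((hkernel j).trans ?_) hweight
          (div_nonneg (hG₀ _) (Real.rpow_nonneg hb0.le _)) (by positivity)
        gcongr
    _ = A * Real.exp (β * (2 - x)) * (C * (2 ^ (β - 1) + 1)) *
          (Real.exp (-β * p.1) * ((1 + p.2 ^ (β - 1)) * Real.exp (-β * p.2))) := by
        rw [show -(β * (p.1 + p.2 + x - 2)) = β * (2 - x) + -β * p.1 + -β * p.2 by ring,
          Real.exp_add, Real.exp_add]
        ring

end MeanNumber

section GammaIntegral

variable {β : ℝ}

lemma integrableOn_rpow_sub_one_mul_exp_neg_mul (hβ : 0 < β) :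
    IntegrableOn (fun w : ℝ => w ^ (β - 1) * Real.exp (-β * w)) (Set.Ioi 0) := by
  simpa only [Real.rpow_one] using
    integrableOn_rpow_mul_exp_neg_mul_rpow (p := 1) (s := β - 1) (by linarith) one_pos hβ

lemma integrable_exp_mul_rpow_mul_exp (hβ : 0 < β) :
    Integrable (fun p : ℝ × ℝ => Real.exp (-β * p.1) * (p.2 ^ (β - 1) * Real.exp (-β * p.2)))
      quadrantVolume :=
  Integrable.mul_prod (exp_neg_integrableOn_Ioi 0 hβ)
    (integrableOn_rpow_sub_one_mul_exp_neg_mul hβ)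

lemma integrable_exp_mul_one_add_rpow_mul_exp (hβ : 0 < β) :
    Integrable
      (fun p : ℝ × ℝ => Real.exp (-β * p.1) * ((1 + p.2 ^ (β - 1)) * Real.exp (-β * p.2)))
      quadrantVolume := by
  refine Integrable.mul_prod (g := fun w => (1 + w ^ (β - 1)) * Real.exp (-β * w))
    (exp_neg_integrableOn_Ioi 0 hβ) ?_
  simp only [add_mul, one_mul]
  exact (exp_neg_integrableOn_Ioi 0 hβ).add (integrableOn_rpow_sub_one_mul_exp_neg_mul hβ)

lemma integral_exp_mul_rpow_mul_exp (hβ : 0 < β) :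
    ∫ p : ℝ × ℝ, Real.exp (-β * p.1) * (p.2 ^ (β - 1) * Real.exp (-β * p.2)) ∂quadrantVolume =
      Real.Gamma β / β ^ (β + 1) := by
  rw [quadrantVolume, integral_prod_mul (fun v : ℝ => Real.exp (-β * v))
    (fun w : ℝ => w ^ (β - 1) * Real.exp (-β * w)), integral_exp_mul_Ioi (by linarith)]
  simp only [neg_mul]
  rw [Real.integral_rpow_mul_exp_neg_mul_Ioi hβ hβ, Real.rpow_add hβ, Real.rpow_one, one_div,
    Real.inv_rpow hβ.le]
  simp only [mul_zero, neg_zero, Real.exp_zero]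
  field_simp

lemma lintegral_limit_rescaledSummand (d : ℕ) {K : ℝ} (hβ : 0 < β) (hK : 0 ≤ K)
    (x : ℝ) :
    ∫⁻ p, ENNReal.ofReal (β ^ ((β + 1) / 2) / d ^ (β / 2) *
        Real.exp (-(β * (p.1 + p.2 + x))) * (K * p.2 ^ (β - 1))) ∂quadrantVolume =
      ENNReal.ofReal
        (Real.Gamma β / (d ^ (β / 2) * β ^ ((β + 1) / 2)) * K * Real.exp (-(β * x))) := by
  have hfactor (p : ℝ × ℝ) : β ^ ((β + 1) / 2) / d ^ (β / 2) *
        Real.exp (-(β * (p.1 + p.2 + x))) * (K * p.2 ^ (β - 1)) =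
      β ^ ((β + 1) / 2) / d ^ (β / 2) * Real.exp (-(β * x)) * K *
        (Real.exp (-β * p.1) * (p.2 ^ (β - 1) * Real.exp (-β * p.2))) := by
    rw [show -(β * (p.1 + p.2 + x)) = -(β * x) + -β * p.1 + -β * p.2 by ring,
      Real.exp_add, Real.exp_add]
    ring
  have hpow : β ^ (β + 1) = β ^ ((β + 1) / 2) * β ^ ((β + 1) / 2) := by
    rw [← Real.rpow_add hβ, add_halves]
  simp only [hfactor]
  rw [← ofReal_integral_eq_lintegral_ofReal ((integrable_exp_mul_rpow_mul_exp hβ).const_mul _),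
    integral_const_mul, integral_exp_mul_rpow_mul_exp hβ, hpow]
  · congr 1
    field_simp
  · filter_upwards [ae_quadrantVolume_pos] with p hp
    have := hp.2
    positivity

end GammaIntegral

lemma tendsto_tsum_tsum_heatKernel_mul {d : ℕ} [NeZero d] {β K : ℝ} {G : ℕ → ℝ} (hβ : 0 < β)
    (hG₀ : 0 ≤ G) (hG : Tendsto (fun u : ℕ => G u / (u : ℝ) ^ (β - 1)) atTop (𝓝 K)) (x : ℝ) :
    Tendsto (fun t => ∑' (j : ℕ) (u : ℕ),
        ENNReal.ofReal (heatKernel d t (⌊level d β x t⌋ + 1 + j + u)) * ENNReal.ofReal (G u)) atTop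
      (𝓝 (ENNReal.ofReal
        (Real.Gamma β / (d ^ (β / 2) * β ^ ((β + 1) / 2)) * K * Real.exp (-(β * x))))) := by
  have hK : 0 ≤ K := ge_of_tendsto' hG fun u => div_nonneg (hG₀ u) (by positivity)
  obtain ⟨B, hB⟩ := exists_rescaledSummand_le (d := d) hβ hG₀ hG x
  have hlim := tendsto_lintegral_filter_of_dominated_convergence (μ := quadrantVolume) _
    (.of_forall fun t => (measurable_rescaledSummand d β G x t).ennreal_ofReal)
    (hB.mono fun t h => ae_quadrantVolume_pos.mono fun p hp => ENNReal.ofReal_le_ofReal (h p hp))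
    ((integrable_exp_mul_one_add_rpow_mul_exp hβ).const_mul B).lintegral_lt_top.ne
    (ae_quadrantVolume_pos.mono fun p hp =>
      ENNReal.tendsto_ofReal (tendsto_rescaledSummand hβ hG x hp))
  rw [← lintegral_limit_rescaledSummand d hβ hK]
  refine hlim.congr' ?_
  filter_upwards [eventually_gt_atTop 1] with t ht
  exact (tsum_tsum_heatKernel_eq_lintegral hβ G x ht).symm

section CrossSection

variable {n : ℕ} {g : Fin n → ℝ → ℝ}

/-- The number of lattice points of the box `{k : ∀ i, |k_i| ≤ g_i(u)}`, the slice of the profile at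
first coordinate `-u`. The formula is the box count only where the `g_i(u)` are nonnegative. -/
def crossSection (g : Fin n → ℝ → ℝ) (u : ℝ) : ℕ := ∏ i, (2 * ⌊g i u⌋₊ + 1)

lemma slice_profile_of_pos (g : Fin n → ℝ → ℝ) {p : ℤ} (hp : 0 < p) :
    slice (profile g) p = ∅ := by
  simp [slice, profile, hp.not_ge]

lemma slice_profile_neg {u : ℕ} (hg : ∀ i, 0 ≤ g i u) :
    slice (profile g) (-u) =
      Fintype.piFinset fun i => Finset.Icc (-(⌊g i u⌋₊ : ℤ)) ⌊g i u⌋₊ := by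
  ext k
  simp only [slice, profile, Set.mem_ofPred_eq, Fin.cons_zero, Fin.cons_succ, decide_eq_true_eq,
    Finset.mem_coe, Fintype.mem_piFinset, Finset.mem_Icc, Left.neg_nonpos_iff, Nat.cast_nonneg,
    true_and]
  refine forall_congr' fun i => ?_
  rw [← abs_le, Int.natCast_floor_eq_floor (hg i), Int.le_floor]
  push_cast
  rw [neg_neg]

lemma encard_slice_profile {u : ℕ} (hg : ∀ i, 0 ≤ g i u) :
    (slice (profile g) (-u)).encard = crossSection g u := by
  rw [slice_profile_neg hg, Set.encard_coe_eq_coe_finsetCard, Fintype.card_piFinset, crossSection]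
  congr 1
  refine Finset.prod_congr rfl fun i _ => ?_
  rw [Int.card_Icc]
  omega

end CrossSection

section PolyShape

variable {n : ℕ} {c α r : Fin n → ℝ}

lemma polyShape_nonneg (hc : ∀ i, 0 < c i) (hr : ∀ i, 0 ≤ r i) (i : Fin n) {u : ℝ} (hu : 0 ≤ u) :
    0 ≤ polyShape c α r i u :=
  add_nonneg (mul_nonneg (hc i).le (Real.rpow_nonneg hu _)) (hr i)

lemma beta_pos (hα : ∀ i, 0 ≤ α i) : 0 < beta α :=
  add_pos_of_pos_of_nonneg one_pos (Finset.sum_nonneg fun i _ => hα i)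

lemma tendsto_polyShape_div_rpow {i : Fin n} (hi : 0 < α i) :
    Tendsto (fun u => polyShape c α r i u / u ^ α i) atTop (𝓝 (c i)) := by
  have hlim := (tendsto_inv_atTop_zero.comp (tendsto_rpow_atTop hi)).const_mul (r i)
  rw [mul_zero] at hlim
  refine ((hlim.const_add (c i)).congr' ?_).trans_eq (by rw [add_zero])
  filter_upwards [eventually_gt_atTop 0] with u hu
  have : 0 < u ^ α i := Real.rpow_pos_of_pos hu _
  rw [polyShape, Function.comp]
  field_simp

lemma tendsto_floor_polyShape_div_rpow (hc : ∀ i, 0 < c i) {i : Fin n} (hi : 0 < α i) :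
    Tendsto (fun u => (2 * ⌊polyShape c α r i u⌋₊ + 1) / u ^ α i) atTop (𝓝 (2 * c i)) := by
  have hshape : Tendsto (polyShape c α r i) atTop atTop :=
    tendsto_atTop_add_const_right _ _ ((tendsto_rpow_atTop hi).const_mul_atTop (hc i))
  have hlim := ((((tendsto_nat_floor_div_atTop (R := ℝ)).comp hshape).mul
    (tendsto_polyShape_div_rpow (c := c) (r := r) hi)).const_mul 2).add
      (tendsto_inv_atTop_zero.comp (tendsto_rpow_atTop hi))
  rw [one_mul, add_zero] at hlim
  refine hlim.congr' ?_
  filter_upwards [hshape.eventually_gt_atTop 0, eventually_gt_atTop 0] with u hpos hu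
  have : 0 < u ^ α i := Real.rpow_pos_of_pos hu _
  simp only [Function.comp]
  field_simp

open Classical in
/-- The coefficient of `u^{β-1}` in the asymptotics of the cross-section of the polynomial shapes at
distance `u` below the origin. -/
def leadingCoeff (c α r : Fin n → ℝ) : ℝ :=
  (∏ i with α i = 0, (2 * (⌊c i + r i⌋ : ℝ) + 1)) * ∏ i with 0 < α i, 2 * c i

lemma limitConst_eq (c α r : Fin n → ℝ) :
    limitConst c α r = Real.Gamma (beta α) /
      (((n + 1 : ℕ) : ℝ) ^ (beta α / 2) * beta α ^ ((beta α + 1) / 2)) * leadingCoeff c α r :=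
  mul_assoc _ _ _

lemma tendsto_crossSection_polyShape_div_rpow (hc : ∀ i, 0 < c i) (hα : ∀ i, 0 ≤ α i)
    (hr : ∀ i, 0 ≤ r i) :
    Tendsto (fun u : ℕ => (crossSection (polyShape c α r) u : ℝ) / (u : ℝ) ^ (beta α - 1)) atTop
      (𝓝 (leadingCoeff c α r)) := by
  classical
  have hcoeff : leadingCoeff c α r =
      ∏ i, if α i = 0 then 2 * (⌊c i + r i⌋ : ℝ) + 1 else 2 * c i := by
    simp only [leadingCoeff, Finset.prod_ite, fun i => (hα i).lt_iff_ne', ne_eq]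
  have hprod : Tendsto (fun u => ∏ i, (2 * ⌊polyShape c α r i u⌋₊ + 1) / u ^ α i) atTop
      (𝓝 (leadingCoeff c α r)) := by
    rw [hcoeff]
    refine tendsto_finsetProd _ fun i _ => ?_
    split_ifs with hi
    · simp only [polyShape, hi, Real.rpow_zero, mul_one, div_one,
        natCast_floor_eq_intCast_floor (add_nonneg (hc i).le (hr i)), tendsto_const_nhds]
    · exact tendsto_floor_polyShape_div_rpow hc ((hα i).lt_of_ne' hi)
  refine (hprod.comp tendsto_natCast_atTop_atTop).congr' ?_
  filter_upwards [eventually_gt_atTop 0] with u hu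
  have hu' : (0 : ℝ) < u := by exact_mod_cast hu
  rw [Function.comp, Finset.prod_div_distrib, ← Real.rpow_sum_of_pos hu', crossSection, beta,
    add_sub_cancel_left]
  push_cast
  rfl

end PolyShape

end SSEP

end

theorem lemma5p2_general {n : ℕ} {β K : ℝ} (hβ : 0 < β) {G : ℕ → ℕ}
    (hG : Tendsto (fun u : ℕ => (G u : ℝ) / (u : ℝ) ^ (β - 1)) atTop (𝓝 K))
    {η₀ : SSEP.Config (n + 1)} (hpos : ∀ p : ℤ, 0 < p → SSEP.slice η₀ p = ∅)
    (hslice : ∀ u : ℕ, (SSEP.slice η₀ (-u)).encard = G u) (x : ℝ)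
    {Ω : Type*} {m : MeasurableSpace Ω} {μ : Measure Ω} [IsProbabilityMeasure μ]
    {ℱ : Filtration ℝ≥0 m} {η : ℝ≥0 → Ω → SSEP.Config (n + 1)} (hη : SSEP.IsSSEP μ ℱ η η₀) :
    Tendsto (fun t : ℝ≥0 => ∫⁻ ω, SSEP.numAbove (SSEP.level (n + 1) β x t) (η t ω) ∂μ) atTop
      (𝓝 (ENNReal.ofReal
        (Real.Gamma β / (((n + 1 : ℕ) : ℝ) ^ (β / 2) * β ^ ((β + 1) / 2)) * K *
          Real.exp (-(β * x))))) := by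
  refine ((SSEP.tendsto_tsum_tsum_heatKernel_mul hβ (fun u => (G u).cast_nonneg) hG x).comp
    (NNReal.tendsto_coe_atTop.2 tendsto_id)).congr fun t => ?_
  rw [hη.lintegral_numAbove_eq_tsum_heatKernel hpos]
  simp only [Function.comp, id, hslice, ENat.toENNReal_coe, ENNReal.ofReal_natCast]

/-- The dimension is `d = n + 1 ≥ 2`. -/
theorem lemma5p2 (n : ℕ) (hn : 1 ≤ n) (c α r : Fin n → ℝ)
    (hc : ∀ i, 0 < c i) (hα : ∀ i, 0 ≤ α i) (hr : ∀ i, 0 ≤ r i) (x : ℝ)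
    {Ω : Type*} {m : MeasurableSpace Ω} (μ : Measure Ω) [IsProbabilityMeasure μ]
    (ℱ : Filtration ℝ≥0 m) (η : ℝ≥0 → Ω → SSEP.Config (n + 1))
    (hη : SSEP.IsSSEP μ ℱ η (SSEP.profile (SSEP.polyShape c α r))) :
    Tendsto
      (fun t : ℝ≥0 => ∫⁻ ω, SSEP.numAbove (SSEP.level (n + 1) (SSEP.beta α) x t) (η t ω) ∂μ)
      atTop
      (𝓝 (ENNReal.ofReal (SSEP.limitConst c α r * Real.exp (-(SSEP.beta α * x))))) := by
  rw [SSEP.limitConst_eq]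
  exact lemma5p2_general (SSEP.beta_pos hα) (SSEP.tendsto_crossSection_polyShape_div_rpow hc hα hr)
    (fun _ => SSEP.slice_profile_of_pos _)
    (fun u => SSEP.encard_slice_profile fun i => SSEP.polyShape_nonneg hc hr i u.cast_nonneg) x hη
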